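/- Let $K$ be a field, let $\mathscr X$ be a (small) poset, viewed as a category with exactly one morphism $x\to y$ when $x\le y$ and none otherwise, and let $\mathcal C:\mathscr X\to \mathrm{Coalg}$ be a functor to the category of $K$-coalgebras (a coalgebra representation), with value $\mathcal C_x$ at $x$ and $\mathcal C_\alpha:\mathcal C_x\to\mathcal C_y$ at $\alpha:x\to y$. For a coalgebra $C$ write $\mathbf M^C$ for the category of right $C$-comodules. A coalgebra morphism $\alpha:C\to D$ induces the corestriction functor $\alpha^*:\mathbf M^C\to\mathbf M^D$, $(M,\rho)\mapsto (M,(\mathrm{id}\otimes\alpha)\rho)$, and its right adjoint, the coinduction functor $\alpha_*=-\,\square_D\,C:\mathbf M^D\to\mathbf M^C$ given by the cotensor product over $D$. For $\alpha:x\to y$ in $\mathscr X$ write $\alpha^*,\alpha_*$ for $(\mathcal C_\alpha)^*,(\mathcal C_\alpha)_*$. Assume that - $\mathcal C$ is left coflat: for every $\alpha:x\to y$ in $\mathscr X$ the functor $\alpha_*=-\,\square_{\mathcal C_y}\mathcal C_x:\mathbf M^{\mathcal C_y}\to \mathbf M^{\mathcal C_x}$ is exact; - $\mathcal C$ takes values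 in right semiperfect coalgebras: for every $x\in\mathscr X$ the category $\mathbf M^{\mathcal C_x}$ has enough projectives. A right cis-comodule $\mathcal M$ over $\mathcal C$ consists of a right $\mathcal C_x$-comodule $\mathcal M_x$ for each $x\in\mathscr X$ and a morphism $\mathcal M^\alpha:\alpha^*\mathcal M_x\to\mathcal M_y$ of right $\mathcal C_y$-comodules for each $\alpha:x\to y$ (equivalently, by adjunction, a morphism $\mathcal M_\alpha:\mathcal M_x\to\alpha_*\mathcal M_y$ of right $\mathcal C_x$-comodules), such that $\mathcal M^{\mathrm{id}_x}=\mathrm{id}$ and $\mathcal M^{\beta\alpha}=\mathcal M^\beta\circ\beta^*(\mathcal M^\alpha)$ for composable $\alpha,\beta$. A morphism $\eta:\mathcal M\to\mathcal N$ of cis-comodules is a family of morphisms $\eta_x:\mathcal M_x\to\mathcal N_x$ in $\mathbf M^{\mathcal C_x}$ with $\alpha_*(\eta_y)\circ\mathcal M_\alpha=\mathcal N_\alpha\circ\eta_x$ for all $\alpha:x\to y$. Let $Com^{cs}\text{-}\mathcal C$ be the resulting category, and let $Com^{cs}_c\text{-}\mathcal C$ be its full subcategory of cartesian objects, i.e.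 those $\mathcal M$ for which every $\mathcal M_\alpha:\mathcal M_x\to\alpha_*\mathcal M_y$ is an isomorphism. Then the inclusion functor $Com^{cs}_c\text{-}\mathcal C\hookrightarrow Com^{cs}\text{-}\mathcal C$ has a right adjoint. -/

import Mathlib

open CategoryTheory TensorProduct

universe u

noncomputable section

/-- A right comodule over a `K`-coalgebra `C`: a `K`-vector space `M` with a coassociative and
counital coaction `ρ : M → M ⊗ C`. -/
structure RightComod (K : Type u) [Field K] (C : Type u) [AddCommGroup C] [Module K C]
    [Coalgebra K C] where
  carrier : Type u
  [addCommGroup : AddCommGroup carrier]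
  [module : Module K carrier]
  ρ : carrier →ₗ[K] carrier ⊗[K] C
  coassoc : (TensorProduct.assoc K carrier C C).toLinearMap ∘ₗ ρ.rTensor C ∘ₗ ρ =
    (Coalgebra.comul (R := K) (A := C)).lTensor carrier ∘ₗ ρ
  counit : (Coalgebra.counit (R := K) (A := C)).lTensor carrier ∘ₗ ρ =
    (TensorProduct.mk K carrier K).flip 1

attribute [instance] RightComod.addCommGroup RightComod.module

namespace RightComod

section

variable {K : Type u} [Field K] {C : Type u} [AddCommGroup C] [Module K C] [Coalgebra K C]

/-- A morphism of right `C`-comodules: a `K`-linear map commuting with the coactions. -/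
@[ext]
structure Hom (M N : RightComod K C) where
  lin : M.carrier →ₗ[K] N.carrier
  comm : N.ρ ∘ₗ lin = lin.rTensor C ∘ₗ M.ρ

theorem Hom.comm_apply {M N : RightComod K C} (f : Hom M N) (m : M.carrier) :
    N.ρ (f.lin m) = f.lin.rTensor C (M.ρ m) :=
  LinearMap.congr_fun f.comm m

/-- The category `𝐌^C` of right `C`-comodules. -/
instance : Category (RightComod K C) where
  Hom M N := Hom M N
  id M := { lin := LinearMap.id, comm := by simp }
  comp {M N P} f g :=
    { lin := g.lin ∘ₗ f.lin
      comm := by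
        rw [← LinearMap.comp_assoc, g.comm, LinearMap.comp_assoc, f.comm,
          ← LinearMap.comp_assoc, ← LinearMap.rTensor_comp] }

@[simp] theorem id_lin (M : RightComod K C) : Hom.lin (𝟙 M) = LinearMap.id := rfl

@[simp] theorem comp_lin {M N P : RightComod K C} (f : M ⟶ N) (g : N ⟶ P) :
    Hom.lin (f ≫ g) = Hom.lin g ∘ₗ Hom.lin f := rfl

@[ext] theorem hom_ext {M N : RightComod K C} {f g : M ⟶ N} (h : Hom.lin f = Hom.lin g) : f = g :=
  Hom.ext h

theorem coassoc_apply (M : RightComod K C) (m : M.carrier) :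
    TensorProduct.assoc K M.carrier C C (M.ρ.rTensor C (M.ρ m)) =
      (Coalgebra.comul (R := K) (A := C)).lTensor M.carrier (M.ρ m) :=
  LinearMap.congr_fun M.coassoc m

theorem counit_apply (M : RightComod K C) (m : M.carrier) :
    (Coalgebra.counit (R := K) (A := C)).lTensor M.carrier (M.ρ m) = m ⊗ₜ 1 :=
  LinearMap.congr_fun M.counit m

end

section

variable {K : Type u} [Field K]
  {C : Type u} [AddCommGroup C] [Module K C] [Coalgebra K C]
  {D : Type u} [AddCommGroup D] [Module K D] [Coalgebra K D]

/-- The object part of corestriction: `(M, ρ) ↦ (M, (id ⊗ α) ∘ ρ)`. -/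
@[simps carrier ρ]
def corestrictObj (α : C →ₗc[K] D) (M : RightComod K C) : RightComod K D where
  carrier := M.carrier
  ρ := α.toLinearMap.lTensor M.carrier ∘ₗ M.ρ
  coassoc := by
    have h1 : (TensorProduct.assoc K M.carrier D D).toLinearMap ∘ₗ
        (α.toLinearMap.lTensor M.carrier ∘ₗ M.ρ).rTensor D ∘ₗ α.toLinearMap.lTensor M.carrier =
        (TensorProduct.map α.toLinearMap α.toLinearMap).lTensor M.carrier ∘ₗ
          (TensorProduct.assoc K M.carrier C C).toLinearMap ∘ₗ M.ρ.rTensor C := by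
      ext m c
      simp only [AlgebraTensorModule.curry_apply, curry_apply, LinearMap.coe_comp,
        LinearMap.coe_restrictScalars, Function.comp_apply, LinearMap.lTensor_tmul,
        LinearMap.rTensor_tmul, LinearEquiv.coe_coe]
      generalize M.ρ m = t
      induction t with
      | zero => simp
      | tmul a b => simp
      | add a b ha hb => simp only [map_add, add_tmul, ha, hb]
    rw [← LinearMap.comp_assoc, ← LinearMap.comp_assoc, LinearMap.comp_assoc _ _ (LinearEquiv.toLinearMap _), h1,
      LinearMap.comp_assoc, LinearMap.comp_assoc, M.coassoc, ← LinearMap.comp_assoc,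
      ← LinearMap.comp_assoc, ← LinearMap.lTensor_comp, ← LinearMap.lTensor_comp,
      α.map_comp_comul]
  counit := by
    rw [← LinearMap.comp_assoc, ← LinearMap.lTensor_comp, α.counit_comp, M.counit]

/-- The corestriction functor `α^* : 𝐌^C ⥤ 𝐌^D` of a coalgebra morphism `α : C → D`. -/
def corestrict (α : C →ₗc[K] D) : RightComod K C ⥤ RightComod K D where
  obj M := corestrictObj α M
  map {M N} f :=
    { lin := Hom.lin (M := M) (N := N) f
      comm := by
        have hf := Hom.comm f
        let l : M.carrier →ₗ[K] N.carrier := Hom.lin f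
        change N.ρ ∘ₗ l = l.rTensor C ∘ₗ M.ρ at hf
        change (α.toLinearMap.lTensor N.carrier ∘ₗ N.ρ) ∘ₗ l =
          l.rTensor D ∘ₗ (α.toLinearMap.lTensor M.carrier ∘ₗ M.ρ)
        rw [LinearMap.comp_assoc, hf, ← LinearMap.comp_assoc, ← LinearMap.comp_assoc,
          LinearMap.lTensor_comp_rTensor, LinearMap.rTensor_comp_lTensor] }

/-- `ρ^M ⊗ id_C : M ⊗ C → M ⊗ D ⊗ C`. -/
def cotensorLeft (C : Type u) [AddCommGroup C] [Module K C] (M : RightComod K D) :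
    M.carrier ⊗[K] C →ₗ[K] M.carrier ⊗[K] (D ⊗[K] C) :=
  (TensorProduct.assoc K M.carrier D C).toLinearMap ∘ₗ M.ρ.rTensor C

/-- `id_M ⊗ λ : M ⊗ C → M ⊗ D ⊗ C`, where `λ = (α ⊗ id) ∘ Δ_C` is the left `D`-coaction on `C`
induced by `α : C → D`. -/
def cotensorRight (α : C →ₗc[K] D) (M : RightComod K D) :
    M.carrier ⊗[K] C →ₗ[K] M.carrier ⊗[K] (D ⊗[K] C) :=
  (α.toLinearMap.rTensor C ∘ₗ Coalgebra.comul).lTensor M.carrier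

/-- The cotensor product `M □_D C`, as a subspace of `M ⊗ C`: the equalizer of `ρ^M ⊗ id_C`
and `id_M ⊗ λ`. -/
def cotensor (α : C →ₗc[K] D) (M : RightComod K D) : Submodule K (M.carrier ⊗[K] C) :=
  LinearMap.eqLocus (cotensorLeft C M) (cotensorRight α M)

/-- `id_M ⊗ Δ_C : M ⊗ C → (M ⊗ C) ⊗ C`. -/
def freeCoaction (C : Type u) [AddCommGroup C] [Module K C] [Coalgebra K C]
    (M : Type u) [AddCommGroup M] [Module K M] :
    M ⊗[K] C →ₗ[K] (M ⊗[K] C) ⊗[K] C :=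
  (TensorProduct.assoc K M C C).symm.toLinearMap ∘ₗ
    (Coalgebra.comul (R := K) (A := C)).lTensor M

theorem rTensor_comp_freeCoaction {M N : Type u} [AddCommGroup M] [Module K M]
    [AddCommGroup N] [Module K N] (f : M →ₗ[K] N) :
    (f.rTensor C).rTensor C ∘ₗ freeCoaction C M = freeCoaction C N ∘ₗ f.rTensor C := by
  ext m c
  simp only [AlgebraTensorModule.curry_apply, curry_apply, LinearMap.coe_comp, freeCoaction,
    LinearMap.coe_restrictScalars, Function.comp_apply, LinearMap.lTensor_tmul,
    LinearMap.rTensor_tmul, LinearEquiv.coe_coe]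
  generalize Coalgebra.comul (R := K) c = t
  induction t with
  | zero => simp
  | tmul a b => simp
  | add a b ha hb => simp only [map_add, tmul_add, ha, hb]

theorem freeCoaction_coassoc (M : Type u) [AddCommGroup M] [Module K M] :
    (TensorProduct.assoc K (M ⊗[K] C) C C).toLinearMap ∘ₗ (freeCoaction C M).rTensor C ∘ₗ
        freeCoaction C M =
      (Coalgebra.comul (R := K) (A := C)).lTensor (M ⊗[K] C) ∘ₗ freeCoaction C M := by
  have h1 : (TensorProduct.assoc K (M ⊗[K] C) C C).toLinearMap ∘ₗ
      (freeCoaction C M).rTensor C ∘ₗ (TensorProduct.assoc K M C C).symm.toLinearMap =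
      (TensorProduct.assoc K M C (C ⊗[K] C)).symm.toLinearMap ∘ₗ
      ((TensorProduct.assoc K C C C).toLinearMap ∘ₗ
        (Coalgebra.comul (R := K) (A := C)).rTensor C).lTensor M := by
    ext m c d
    simp only [AlgebraTensorModule.curry_apply, curry_apply, LinearMap.coe_comp, freeCoaction,
      LinearMap.coe_restrictScalars, Function.comp_apply, LinearMap.lTensor_tmul,
      LinearMap.rTensor_tmul, LinearEquiv.coe_coe, TensorProduct.assoc_symm_tmul]
    generalize Coalgebra.comul (R := K) c = t
    induction t with
    | zero => simp
    | tmul a b => simp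
    | add a b ha hb => simp only [map_add, add_tmul, tmul_add, ha, hb]
  have h2 : (Coalgebra.comul (R := K) (A := C)).lTensor (M ⊗[K] C) ∘ₗ
      (TensorProduct.assoc K M C C).symm.toLinearMap =
      (TensorProduct.assoc K M C (C ⊗[K] C)).symm.toLinearMap ∘ₗ
        ((Coalgebra.comul (R := K) (A := C)).lTensor C).lTensor M := by
    ext m c d
    simp
  calc _ = ((TensorProduct.assoc K (M ⊗[K] C) C C).toLinearMap ∘ₗ
      (freeCoaction C M).rTensor C ∘ₗ (TensorProduct.assoc K M C C).symm.toLinearMap) ∘ₗ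
        (Coalgebra.comul (R := K) (A := C)).lTensor M := rfl
    _ = ((Coalgebra.comul (R := K) (A := C)).lTensor (M ⊗[K] C) ∘ₗ
      (TensorProduct.assoc K M C C).symm.toLinearMap) ∘ₗ
        (Coalgebra.comul (R := K) (A := C)).lTensor M := by
      rw [h1, h2, LinearMap.comp_assoc, LinearMap.comp_assoc, ← LinearMap.lTensor_comp,
        ← LinearMap.lTensor_comp, LinearMap.comp_assoc, Coalgebra.coassoc]
    _ = _ := rfl

theorem freeCoaction_counit (M : Type u) [AddCommGroup M] [Module K M] :
    (Coalgebra.counit (R := K) (A := C)).lTensor (M ⊗[K] C) ∘ₗ freeCoaction C M =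
      (TensorProduct.mk K (M ⊗[K] C) K).flip 1 := by
  have h1 : (Coalgebra.counit (R := K) (A := C)).lTensor (M ⊗[K] C) ∘ₗ
      (TensorProduct.assoc K M C C).symm.toLinearMap =
      (TensorProduct.assoc K M C K).symm.toLinearMap ∘ₗ
        ((Coalgebra.counit (R := K) (A := C)).lTensor C).lTensor M := by
    ext m c d
    simp
  calc _ = ((Coalgebra.counit (R := K) (A := C)).lTensor (M ⊗[K] C) ∘ₗ
      (TensorProduct.assoc K M C C).symm.toLinearMap) ∘ₗ
        (Coalgebra.comul (R := K) (A := C)).lTensor M := rfl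
    _ = _ := by
      rw [h1, LinearMap.comp_assoc, ← LinearMap.lTensor_comp,
        Coalgebra.lTensor_counit_comp_comul]
      ext m c
      simp

theorem freeCoaction_mem (α : C →ₗc[K] D) (M : RightComod K D) (w : cotensor α M) :
    freeCoaction C M.carrier w ∈ LinearMap.range ((cotensor α M).subtype.rTensor C) := by
  let ψ : M.carrier ⊗[K] (D ⊗[K] C) →ₗ[K] (M.carrier ⊗[K] (D ⊗[K] C)) ⊗[K] C :=
    (TensorProduct.assoc K M.carrier (D ⊗[K] C) C).symm.toLinearMap ∘ₗ
      (freeCoaction C D).lTensor M.carrier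
  have hl : (cotensorLeft C M).rTensor C ∘ₗ freeCoaction C M.carrier = ψ ∘ₗ cotensorLeft C M := by
    ext m c
    simp only [AlgebraTensorModule.curry_apply, curry_apply, LinearMap.coe_comp, freeCoaction,
      LinearMap.coe_restrictScalars, Function.comp_apply, LinearMap.lTensor_tmul,
      LinearMap.rTensor_tmul, LinearEquiv.coe_coe, cotensorLeft, ψ]
    have key : ∀ s : C ⊗[K] C, ∀ t : M.carrier ⊗[K] D,
        LinearMap.rTensor C ((TensorProduct.assoc K M.carrier D C).toLinearMap)
          ((TensorProduct.assoc K (M.carrier ⊗[K] D) C C).symm (t ⊗ₜ s)) =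
        (TensorProduct.assoc K M.carrier (D ⊗[K] C) C).symm
          (((TensorProduct.assoc K D C C).symm.toLinearMap).lTensor M.carrier
            (TensorProduct.assoc K M.carrier D (C ⊗[K] C) (t ⊗ₜ s))) := by
      intro s t
      induction t with
      | zero => simp
      | add a b ha hb => simp only [map_add, add_tmul, ha, hb]
      | tmul a b =>
        induction s with
        | zero => simp
        | add x y hx hy => simp only [map_add, tmul_add, hx, hy]
        | tmul x y => simp
    have e1 : ∀ s : C ⊗[K] C,
        (LinearMap.rTensor C ((TensorProduct.assoc K M.carrier D C).toLinearMap ∘ₗ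
          M.ρ.rTensor C)) ((TensorProduct.assoc K M.carrier C C).symm (m ⊗ₜ s)) =
        LinearMap.rTensor C ((TensorProduct.assoc K M.carrier D C).toLinearMap)
          ((TensorProduct.assoc K (M.carrier ⊗[K] D) C C).symm (M.ρ m ⊗ₜ s)) := by
      intro s
      induction s with
      | zero => simp
      | add x y hx hy => simp only [map_add, tmul_add, hx, hy]
      | tmul x y => simp
    rw [e1, key]
    congr 1
    generalize M.ρ m = t
    induction t with
    | zero => simp
    | add a b ha hb => simp only [map_add, add_tmul, ha, hb]
    | tmul a b => simp
  have hr : (cotensorRight α M).rTensor C ∘ₗ freeCoaction C M.carrier =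
      ψ ∘ₗ cotensorRight α M := by
    have e1 : ∀ f : C →ₗ[K] D ⊗[K] C, (f.lTensor M.carrier).rTensor C ∘ₗ
        (TensorProduct.assoc K M.carrier C C).symm.toLinearMap =
        (TensorProduct.assoc K M.carrier (D ⊗[K] C) C).symm.toLinearMap ∘ₗ
          (f.rTensor C).lTensor M.carrier := by
      intro f
      ext m c d
      simp
    have e2 : (α.toLinearMap.rTensor C).rTensor C ∘ₗ
        (Coalgebra.comul (R := K) (A := C)).rTensor C ∘ₗ Coalgebra.comul =
        freeCoaction C D ∘ₗ (α.toLinearMap.rTensor C ∘ₗ Coalgebra.comul) := by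
      rw [← LinearMap.comp_assoc Coalgebra.comul _ (freeCoaction C D), ← rTensor_comp_freeCoaction, LinearMap.comp_assoc,
        freeCoaction, LinearMap.comp_assoc]
      congr 1
      exact Coalgebra.coassoc_symm.symm
    calc _ = ((cotensorRight α M).rTensor C ∘ₗ
        (TensorProduct.assoc K M.carrier C C).symm.toLinearMap) ∘ₗ
          (Coalgebra.comul (R := K) (A := C)).lTensor M.carrier := rfl
      _ = _ := by
        rw [cotensorRight, e1, LinearMap.comp_assoc, ← LinearMap.lTensor_comp,
          LinearMap.rTensor_comp, LinearMap.comp_assoc, e2, LinearMap.lTensor_comp]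
        rfl
  have hex : Function.Exact (cotensor α M).subtype (cotensorLeft C M - cotensorRight α M) := by
    intro x
    rw [LinearMap.sub_apply, sub_eq_zero, Submodule.coe_subtype, Subtype.range_coe]
    rfl
  have hex' := Module.Flat.rTensor_exact C hex
  have := (hex' (freeCoaction C M.carrier w)).1 (by
    have hw : cotensorLeft C M w = cotensorRight α M w := w.2
    have h1 := LinearMap.congr_fun hl (w : M.carrier ⊗[K] C)
    have h2 := LinearMap.congr_fun hr (w : M.carrier ⊗[K] C)
    simp only [LinearMap.coe_comp, Function.comp_apply] at h1 h2
    rw [LinearMap.rTensor_sub, LinearMap.sub_apply, h1, h2, hw, sub_self])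
  exact this

theorem subtype_rTensor_injective {M : Type u} [AddCommGroup M] [Module K M]
    (W : Submodule K M) (N : Type u) [AddCommGroup N] [Module K N] :
    Function.Injective (W.subtype.rTensor N) :=
  Module.Flat.rTensor_preserves_injective_linearMap _ W.injective_subtype

/-- The right `C`-coaction on `M □_D C`: the restriction of `id_M ⊗ Δ_C`. -/
def cotensorCoaction (α : C →ₗc[K] D) (M : RightComod K D) :
    cotensor α M →ₗ[K] cotensor α M ⊗[K] C :=
  (LinearEquiv.ofInjective _ (subtype_rTensor_injective (cotensor α M) C)).symm.toLinearMap ∘ₗ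
    LinearMap.codRestrict _ (freeCoaction C M.carrier ∘ₗ (cotensor α M).subtype)
      (freeCoaction_mem α M)

theorem subtype_comp_cotensorCoaction (α : C →ₗc[K] D) (M : RightComod K D) :
    (cotensor α M).subtype.rTensor C ∘ₗ cotensorCoaction α M =
      freeCoaction C M.carrier ∘ₗ (cotensor α M).subtype := by
  ext1 w
  have := LinearEquiv.apply_symm_apply
    (LinearEquiv.ofInjective _ (subtype_rTensor_injective (cotensor α M) C))
    (LinearMap.codRestrict _ (freeCoaction C M.carrier ∘ₗ (cotensor α M).subtype)
      (freeCoaction_mem α M) w)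
  exact congrArg Subtype.val this

/-- The object part of coinduction: `M ↦ M □_D C`. -/
@[simps carrier ρ]
def coinduceObj (α : C →ₗc[K] D) (M : RightComod K D) : RightComod K C where
  carrier := cotensor α M
  ρ := cotensorCoaction α M
  coassoc := by
    set W := cotensor α M
    have hinj : Function.Injective (W.subtype.rTensor (C ⊗[K] C)) :=
      subtype_rTensor_injective W (C ⊗[K] C)
    rw [← LinearMap.cancel_left hinj]
    have n1 : W.subtype.rTensor (C ⊗[K] C) ∘ₗ (TensorProduct.assoc K W C C).toLinearMap =
        (TensorProduct.assoc K (M.carrier ⊗[K] C) C C).toLinearMap ∘ₗ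
          (W.subtype.rTensor C).rTensor C := by
      ext w c d
      simp
    have h := subtype_comp_cotensorCoaction α M
    rw [← LinearMap.comp_assoc, n1, LinearMap.comp_assoc, ← LinearMap.comp_assoc _ _ (LinearMap.rTensor C (LinearMap.rTensor C W.subtype)),
      ← LinearMap.rTensor_comp, h, LinearMap.rTensor_comp, LinearMap.comp_assoc, h,
      ← LinearMap.comp_assoc, ← LinearMap.comp_assoc, LinearMap.comp_assoc _ _ (LinearEquiv.toLinearMap _),
      freeCoaction_coassoc, LinearMap.comp_assoc, ← h, ← LinearMap.comp_assoc,
      ← LinearMap.comp_assoc, LinearMap.lTensor_comp_rTensor, LinearMap.rTensor_comp_lTensor]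
  counit := by
    set W := cotensor α M
    have hinj : Function.Injective (W.subtype.rTensor K) := subtype_rTensor_injective W K
    rw [← LinearMap.cancel_left hinj]
    have h := subtype_comp_cotensorCoaction α M
    rw [← LinearMap.comp_assoc, LinearMap.rTensor_comp_lTensor,
      ← LinearMap.lTensor_comp_rTensor, LinearMap.comp_assoc, h, ← LinearMap.comp_assoc,
      freeCoaction_counit]
    ext w
    simp

theorem rTensor_mem_cotensor (α : C →ₗc[K] D) {M N : RightComod K D} (f : M ⟶ N)
    (w : cotensor α M) : (Hom.lin f).rTensor C (w : M.carrier ⊗[K] C) ∈ cotensor α N := by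
  have hl : cotensorLeft C N ∘ₗ (Hom.lin f).rTensor C =
      (Hom.lin f).rTensor (D ⊗[K] C) ∘ₗ cotensorLeft C M := by
    have e : (Hom.lin f).rTensor (D ⊗[K] C) ∘ₗ
        (TensorProduct.assoc K M.carrier D C).toLinearMap =
        (TensorProduct.assoc K N.carrier D C).toLinearMap ∘ₗ
          ((Hom.lin f).rTensor D).rTensor C := by
      ext m d c
      simp
    rw [cotensorLeft, cotensorLeft, LinearMap.comp_assoc, ← LinearMap.rTensor_comp, Hom.comm f,
      LinearMap.rTensor_comp, ← LinearMap.comp_assoc, ← LinearMap.comp_assoc, e]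
  have hr : cotensorRight α N ∘ₗ (Hom.lin f).rTensor C =
      (Hom.lin f).rTensor (D ⊗[K] C) ∘ₗ cotensorRight α M := by
    rw [cotensorRight, cotensorRight, LinearMap.lTensor_comp_rTensor,
      LinearMap.rTensor_comp_lTensor]
  have hw : cotensorLeft C M w = cotensorRight α M w := w.2
  have h1 := LinearMap.congr_fun hl (w : M.carrier ⊗[K] C)
  have h2 := LinearMap.congr_fun hr (w : M.carrier ⊗[K] C)
  simp only [LinearMap.coe_comp, Function.comp_apply] at h1 h2
  rw [cotensor, LinearMap.mem_eqLocus, h1, h2, hw]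

/-- The coinduction functor `α_* = - □_D C : 𝐌^D ⥤ 𝐌^C` of a coalgebra morphism `α : C → D`;
on morphisms it is the restriction of `f ⊗ id_C`. -/
def coinduce (α : C →ₗc[K] D) : RightComod K D ⥤ RightComod K C where
  obj M := coinduceObj α M
  map {M N} f :=
    { lin := LinearMap.codRestrict _ ((Hom.lin f).rTensor C ∘ₗ (cotensor α M).subtype)
        (rTensor_mem_cotensor α f)
      comm := by
        set g : cotensor α M →ₗ[K] cotensor α N := LinearMap.codRestrict _
          ((Hom.lin f).rTensor C ∘ₗ (cotensor α M).subtype) (rTensor_mem_cotensor α f) with hg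
        have hg' : (cotensor α N).subtype ∘ₗ g =
          (Hom.lin f).rTensor C ∘ₗ (cotensor α M).subtype := rfl
        change cotensorCoaction α N ∘ₗ g = g.rTensor C ∘ₗ cotensorCoaction α M
        rw [← LinearMap.cancel_left (subtype_rTensor_injective (cotensor α N) C),
          ← LinearMap.comp_assoc, subtype_comp_cotensorCoaction, LinearMap.comp_assoc, hg',
          ← LinearMap.comp_assoc _ (LinearMap.rTensor C g), ← LinearMap.rTensor_comp, hg', LinearMap.rTensor_comp,
          LinearMap.comp_assoc _ (LinearMap.rTensor C _), subtype_comp_cotensorCoaction, ← LinearMap.comp_assoc,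
          ← LinearMap.comp_assoc, rTensor_comp_freeCoaction] }
  map_id M := by
    ext w
    apply Subtype.ext
    change (LinearMap.rTensor C (LinearMap.id : M.carrier →ₗ[K] M.carrier)) w.1 = w.1
    simp
  map_comp {M N P} f g := by
    ext w
    apply Subtype.ext
    change (LinearMap.rTensor C (Hom.lin g ∘ₗ Hom.lin f)) w.1 =
      LinearMap.rTensor C (Hom.lin g) (LinearMap.rTensor C (Hom.lin f) w.1)
    rw [LinearMap.rTensor_comp]
    rfl

theorem coaction_mem_cotensor (α : C →ₗc[K] D) (M : RightComod K C) (m : M.carrier) :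
    M.ρ m ∈ cotensor α (corestrictObj α M) := by
  have e : cotensorLeft C (corestrictObj α M) =
      (α.toLinearMap.rTensor C).lTensor M.carrier ∘ₗ
        (TensorProduct.assoc K M.carrier C C).toLinearMap ∘ₗ M.ρ.rTensor C := by
    have e' : (TensorProduct.assoc K M.carrier D C).toLinearMap ∘ₗ
        (α.toLinearMap.lTensor M.carrier).rTensor C =
        (α.toLinearMap.rTensor C).lTensor M.carrier ∘ₗ
          (TensorProduct.assoc K M.carrier C C).toLinearMap := by
      ext m c d
      simp
    change (TensorProduct.assoc K M.carrier D C).toLinearMap ∘ₗ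
      (α.toLinearMap.lTensor M.carrier ∘ₗ M.ρ).rTensor C = _
    rw [LinearMap.rTensor_comp, ← LinearMap.comp_assoc, e', LinearMap.comp_assoc]
  change cotensorLeft C (corestrictObj α M) (M.ρ m) =
    cotensorRight α (corestrictObj α M) (M.ρ m)
  rw [e]
  change (α.toLinearMap.rTensor C).lTensor M.carrier
    (TensorProduct.assoc K M.carrier C C (M.ρ.rTensor C (M.ρ m))) =
    (α.toLinearMap.rTensor C ∘ₗ Coalgebra.comul).lTensor M.carrier (M.ρ m)
  rw [M.coassoc_apply, LinearMap.lTensor_comp]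
  rfl

/-- The unit `M → α_* α^* M` of the adjunction, given by the coaction of `M`. -/
def adjUnit (α : C →ₗc[K] D) (M : RightComod K C) :
    M ⟶ (coinduce α).obj ((corestrict α).obj M) where
  lin := LinearMap.codRestrict (cotensor α (corestrictObj α M)) M.ρ (coaction_mem_cotensor α M)
  comm := by
    set g := LinearMap.codRestrict (cotensor α (corestrictObj α M)) M.ρ
      (coaction_mem_cotensor α M)
    have hg : (cotensor α (corestrictObj α M)).subtype ∘ₗ g = M.ρ := rfl
    change cotensorCoaction α (corestrictObj α M) ∘ₗ g = g.rTensor C ∘ₗ M.ρ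
    rw [← LinearMap.cancel_left (subtype_rTensor_injective (cotensor α (corestrictObj α M)) C),
      ← LinearMap.comp_assoc, subtype_comp_cotensorCoaction, LinearMap.comp_assoc, hg,
      ← LinearMap.comp_assoc, ← LinearMap.rTensor_comp, hg]
    ext m
    change (TensorProduct.assoc K M.carrier C C).symm
      ((Coalgebra.comul (R := K) (A := C)).lTensor M.carrier (M.ρ m)) = M.ρ.rTensor C (M.ρ m)
    rw [← M.coassoc_apply, LinearEquiv.symm_apply_apply]

/-- The counit `α^* α_* N → N` of the adjunction: the restriction to `N □_D C` of
`id_N ⊗ ε : N ⊗ C → N`. -/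
def adjCounit (α : C →ₗc[K] D) (N : RightComod K D) :
    (corestrict α).obj ((coinduce α).obj N) ⟶ N where
  lin := (TensorProduct.rid K N.carrier).toLinearMap ∘ₗ
    (Coalgebra.counit (R := K) (A := C)).lTensor N.carrier ∘ₗ (cotensor α N).subtype
  comm := by
    set e : N.carrier ⊗[K] C →ₗ[K] N.carrier := (TensorProduct.rid K N.carrier).toLinearMap ∘ₗ
      (Coalgebra.counit (R := K) (A := C)).lTensor N.carrier with he
    change N.ρ ∘ₗ (e ∘ₗ (cotensor α N).subtype) =
      (e ∘ₗ (cotensor α N).subtype).rTensor D ∘ₗ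
        (α.toLinearMap.lTensor (cotensor α N) ∘ₗ cotensorCoaction α N)
    have r1 : (e ∘ₗ (cotensor α N).subtype).rTensor D ∘ₗ
        (α.toLinearMap.lTensor (cotensor α N) ∘ₗ cotensorCoaction α N) =
        (e.rTensor D ∘ₗ α.toLinearMap.lTensor (N.carrier ⊗[K] C) ∘ₗ
          freeCoaction C N.carrier) ∘ₗ (cotensor α N).subtype := by
      calc _ = (e.rTensor D ∘ₗ (cotensor α N).subtype.rTensor D) ∘ₗ
            (α.toLinearMap.lTensor (cotensor α N) ∘ₗ cotensorCoaction α N) := by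
            rw [LinearMap.rTensor_comp]
        _ = e.rTensor D ∘ₗ (α.toLinearMap.lTensor (N.carrier ⊗[K] C) ∘ₗ
            ((cotensor α N).subtype.rTensor C ∘ₗ cotensorCoaction α N)) := by
            rw [LinearMap.comp_assoc]
            congr 1
            rw [← LinearMap.comp_assoc, ← LinearMap.comp_assoc, LinearMap.rTensor_comp_lTensor,
              LinearMap.lTensor_comp_rTensor]
        _ = _ := by
            rw [subtype_comp_cotensorCoaction]
            rfl
    have r2 : e.rTensor D ∘ₗ α.toLinearMap.lTensor (N.carrier ⊗[K] C) ∘ₗ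
        freeCoaction C N.carrier = α.toLinearMap.lTensor N.carrier := by
      have a1 : e.rTensor D ∘ₗ α.toLinearMap.lTensor (N.carrier ⊗[K] C) ∘ₗ
          (TensorProduct.assoc K N.carrier C C).symm.toLinearMap =
          (α.toLinearMap ∘ₗ (TensorProduct.lid K C).toLinearMap ∘ₗ
            (Coalgebra.counit (R := K) (A := C)).rTensor C).lTensor N.carrier := by
        ext n c d
        simp [he, TensorProduct.smul_tmul]
      calc _ = (e.rTensor D ∘ₗ α.toLinearMap.lTensor (N.carrier ⊗[K] C) ∘ₗ
          (TensorProduct.assoc K N.carrier C C).symm.toLinearMap) ∘ₗ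
            (Coalgebra.comul (R := K) (A := C)).lTensor N.carrier := rfl
        _ = _ := by
          rw [a1, ← LinearMap.lTensor_comp]
          congr 1
          ext c
          simp
    have l1 : N.ρ ∘ₗ e = (TensorProduct.rid K (N.carrier ⊗[K] D)).toLinearMap ∘ₗ
        (Coalgebra.counit (R := K) (A := C)).lTensor (N.carrier ⊗[K] D) ∘ₗ
          N.ρ.rTensor C := by
      ext n c
      simp [he]
    have l2 : (TensorProduct.rid K (N.carrier ⊗[K] D)).toLinearMap ∘ₗ
        (Coalgebra.counit (R := K) (A := C)).lTensor (N.carrier ⊗[K] D) =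
        ((TensorProduct.rid K D).toLinearMap ∘ₗ
          (Coalgebra.counit (R := K) (A := C)).lTensor D).lTensor N.carrier ∘ₗ
          (TensorProduct.assoc K N.carrier D C).toLinearMap := by
      ext n d c
      simp
    have l3 : ((TensorProduct.rid K D).toLinearMap ∘ₗ
          (Coalgebra.counit (R := K) (A := C)).lTensor D).lTensor N.carrier ∘ₗ
          cotensorRight α N = α.toLinearMap.lTensor N.carrier := by
      rw [cotensorRight, ← LinearMap.lTensor_comp]
      congr 1
      rw [LinearMap.comp_assoc, ← LinearMap.comp_assoc _ _ (LinearMap.lTensor D _), LinearMap.lTensor_comp_rTensor,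
        ← LinearMap.rTensor_comp_lTensor, LinearMap.comp_assoc,
        Coalgebra.lTensor_counit_comp_comul]
      ext c
      simp
    rw [r1, r2]
    ext w
    have hw : cotensorLeft C N w = cotensorRight α N w := w.2
    have t1 := LinearMap.congr_fun l1 (w : N.carrier ⊗[K] C)
    have t2 := LinearMap.congr_fun l2 (N.ρ.rTensor C (w : N.carrier ⊗[K] C))
    have t3 := LinearMap.congr_fun l3 (w : N.carrier ⊗[K] C)
    simp only [LinearMap.coe_comp, Function.comp_apply] at t1 t2 t3
    simp only [LinearMap.coe_comp, Function.comp_apply, Submodule.coe_subtype]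
    rw [t1, t2, ← t3, ← hw]
    rfl

/-- The adjunction `α^* ⊣ α_*` between corestriction and coinduction. -/
def corestrictAdj (α : C →ₗc[K] D) : corestrict α ⊣ coinduce α :=
  Adjunction.mkOfUnitCounit
    { unit :=
        { app := adjUnit α
          naturality := fun M N f => by
            apply hom_ext
            apply LinearMap.ext
            intro m
            apply Subtype.ext
            exact Hom.comm_apply f m }
      counit :=
        { app := adjCounit α
          naturality := fun M N f => by
            apply hom_ext
            apply LinearMap.ext
            intro w
            change cotensor α M at w
            change TensorProduct.rid K N.carrier
              ((Coalgebra.counit (R := K) (A := C)).lTensor N.carrier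
                ((Hom.lin f).rTensor C w.1)) =
              Hom.lin f (TensorProduct.rid K M.carrier
                ((Coalgebra.counit (R := K) (A := C)).lTensor M.carrier w.1))
            generalize w.1 = t
            induction t with
            | zero => simp
            | tmul a b => simp
            | add a b ha hb => simp only [map_add, ha, hb] }
      left_triangle := by
        ext M m
        change M.carrier at m
        change TensorProduct.rid K M.carrier
          ((Coalgebra.counit (R := K) (A := C)).lTensor M.carrier (M.ρ m)) = m
        rw [M.counit_apply]
        simp
      right_triangle := by
        ext N w
        apply Subtype.ext
        change cotensor α N at w
        change ((TensorProduct.rid K N.carrier).toLinearMap ∘ₗ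
          (Coalgebra.counit (R := K) (A := C)).lTensor N.carrier ∘ₗ
            (cotensor α N).subtype).rTensor C (cotensorCoaction α N w) = w.1
        have h : (cotensor α N).subtype.rTensor C (cotensorCoaction α N w) =
            freeCoaction C N.carrier w.1 :=
          LinearMap.congr_fun (subtype_comp_cotensorCoaction α N) w
        rw [← LinearMap.comp_assoc, LinearMap.rTensor_comp, LinearMap.comp_apply, h]
        have a1 : ((TensorProduct.rid K N.carrier).toLinearMap ∘ₗ
            (Coalgebra.counit (R := K) (A := C)).lTensor N.carrier).rTensor C ∘ₗ
            (TensorProduct.assoc K N.carrier C C).symm.toLinearMap =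
            ((TensorProduct.lid K C).toLinearMap ∘ₗ
              (Coalgebra.counit (R := K) (A := C)).rTensor C).lTensor N.carrier := by
          ext n c d
          simp [TensorProduct.smul_tmul]
        have a2 : (((TensorProduct.lid K C).toLinearMap ∘ₗ
              (Coalgebra.counit (R := K) (A := C)).rTensor C).lTensor N.carrier) ∘ₗ
              (Coalgebra.comul (R := K) (A := C)).lTensor N.carrier = LinearMap.id := by
          rw [← LinearMap.lTensor_comp]
          ext n c
          simp
        rw [← a1] at a2
        exact LinearMap.congr_fun a2 w.1 }

/-- The morphism `M → α_* N` corresponding to `f : α^* M → N` is `m ↦ (f ⊗ id_C) (ρ m)`. -/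
theorem corestrictAdj_homEquiv_apply (α : C →ₗc[K] D) {M : RightComod K C} {N : RightComod K D}
    (f : (corestrict α).obj M ⟶ N) (m : M.carrier) :
    (show cotensor α N from Hom.lin ((corestrictAdj α).homEquiv M N f) m).1 =
      LinearMap.rTensor C (show M.carrier →ₗ[K] N.carrier from Hom.lin f) (M.ρ m) := by
  rw [Adjunction.homEquiv_unit]
  rfl

end

end RightComod

/-- A coalgebra `C` is right semiperfect if `𝐌^C` has enough projectives. -/
def IsRightSemiperfect (K : Type u) [Field K] (C : Type u) [AddCommGroup C] [Module K C]
    [Coalgebra K C] : Prop :=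
  EnoughProjectives (RightComod K C)

/-- A coalgebra morphism `α : C → D` is left coflat if `α_* = - □_D C : 𝐌^D ⥤ 𝐌^C` is exact:
it carries exact sequences of comodules `L → M → N` to exact sequences. -/
def IsLeftCoflat {K : Type u} [Field K]
    {C : Type u} [AddCommGroup C] [Module K C] [Coalgebra K C]
    {D : Type u} [AddCommGroup D] [Module K D] [Coalgebra K D] (α : C →ₗc[K] D) : Prop :=
  ∀ ⦃L M N : RightComod K D⦄ (f : L ⟶ M) (g : M ⟶ N),
    Function.Exact (RightComod.Hom.lin f) (RightComod.Hom.lin g) →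
      Function.Exact (RightComod.Hom.lin ((RightComod.coinduce α).map f))
        (RightComod.Hom.lin ((RightComod.coinduce α).map g))

section

variable {K : Type u} [Field K] {X : Type u} [SmallCategory X]

/-- A representation `𝒞 : X ⥤ Coalg` is left coflat if all the coalgebra morphisms
`𝒞_α : 𝒞_x → 𝒞_y` are. -/
def IsLeftCoflatRep (𝒞 : X ⥤ CoalgCat.{u} K) : Prop :=
  ∀ ⦃x y : X⦄ (α : x ⟶ y), IsLeftCoflat (𝒞.map α).toCoalgHom

/-- A representation `𝒞 : X ⥤ Coalg` takes values in right semiperfect coalgebras. -/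
def IsRightSemiperfectRep (𝒞 : X ⥤ CoalgCat.{u} K) : Prop :=
  ∀ x : X, IsRightSemiperfect K (𝒞.obj x)

/-- A right cis-comodule over a coalgebra representation `𝒞`: right `𝒞_x`-comodules `ℳ_x` and
morphisms of right `𝒞_y`-comodules `ℳ^α : α^* ℳ_x → ℳ_y` for `α : x ⟶ y`, with `ℳ^id = id` and
`ℳ^(βα) = ℳ^β ∘ β^*(ℳ^α)`. The two axioms are stated on underlying linear maps; corestriction
does not change these. -/
structure CisComod (𝒞 : X ⥤ CoalgCat.{u} K) where
  obj (x : X) : RightComod K (𝒞.obj x)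
  map {x y : X} (α : x ⟶ y) :
    (RightComod.corestrict (𝒞.map α).toCoalgHom).obj (obj x) ⟶ obj y
  map_id (x : X) (m : (obj x).carrier) : RightComod.Hom.lin (map (𝟙 x)) m = m
  map_comp {x y z : X} (α : x ⟶ y) (β : y ⟶ z) (m : (obj x).carrier) :
    RightComod.Hom.lin (map (α ≫ β)) m =
      RightComod.Hom.lin (map β) (RightComod.Hom.lin (map α) m)

namespace CisComod

variable {𝒞 : X ⥤ CoalgCat.{u} K}

/-- The morphism `ℳ_α : ℳ_x → α_* ℳ_y` of right `𝒞_x`-comodules adjoint to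
`ℳ^α : α^* ℳ_x → ℳ_y`. -/
def adjMap (ℳ : CisComod 𝒞) {x y : X} (α : x ⟶ y) :
    ℳ.obj x ⟶ (RightComod.coinduce (𝒞.map α).toCoalgHom).obj (ℳ.obj y) :=
  (RightComod.corestrictAdj (𝒞.map α).toCoalgHom).homEquiv (ℳ.obj x) (ℳ.obj y) (ℳ.map α)

/-- A morphism of cis-comodules: morphisms `η_x : ℳ_x → 𝒩_x` of right `𝒞_x`-comodules such that
`α_*(η_y) ∘ ℳ_α = 𝒩_α ∘ η_x` for every `α : x ⟶ y`. -/
@[ext]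
structure Hom (ℳ 𝒩 : CisComod 𝒞) where
  app (x : X) : ℳ.obj x ⟶ 𝒩.obj x
  naturality {x y : X} (α : x ⟶ y) :
    ℳ.adjMap α ≫ (RightComod.coinduce (𝒞.map α).toCoalgHom).map (app y) = app x ≫ 𝒩.adjMap α

/-- The category `Com^{cs}-𝒞` of right cis-comodules over `𝒞`. -/
instance : Category (CisComod 𝒞) where
  Hom ℳ 𝒩 := Hom ℳ 𝒩
  id ℳ := { app := fun x => 𝟙 _, naturality := fun α => by simp }
  comp f g :=
    { app := fun x => f.app x ≫ g.app x
      naturality := fun α => by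
        rw [Functor.map_comp, ← Category.assoc, f.naturality, Category.assoc, g.naturality,
          Category.assoc] }

/-- `ℳ` is cartesian if every `ℳ_α : ℳ_x → α_* ℳ_y` is an isomorphism in `𝐌^{𝒞_x}`. -/
def IsCartesian (𝒞 : X ⥤ CoalgCat.{u} K) : ObjectProperty (CisComod 𝒞) :=
  fun ℳ => ∀ ⦃x y : X⦄ (α : x ⟶ y), IsIso (ℳ.adjMap α)

end CisComod

/-- The category `Com^{cs}_c-𝒞` of cartesian cis-comodules: the full subcategory of `Com^{cs}-𝒞`
on the cartesian objects. -/
abbrev CartesianCisComod (𝒞 : X ⥤ CoalgCat.{u} K) : Type (u + 1) :=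
  (CisComod.IsCartesian 𝒞).FullSubcategory

/-- The inclusion functor `Com^{cs}_c-𝒞 ⥤ Com^{cs}-𝒞`. -/
abbrev cartesianInclusion (𝒞 : X ⥤ CoalgCat.{u} K) : CartesianCisComod 𝒞 ⥤ CisComod 𝒞 :=
  (CisComod.IsCartesian 𝒞).ι

end

end

/-! A full subcategory closed under direct sums and cokernels and having a small set of generators
should be coreflective; the proof makes this explicit for cartesian cis-comodules. Everything is
carried out on plain linear data (`CisData`, `IsMor`), where kernels, quotients and differences of
maps are those of vector spaces.

Closure. Over a field, tensoring is exact and commutes with direct sums, so kernels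
(`CisData.exists_ker`) and direct sums (`CisData.IsCart.sum`) of cartesian objects are cartesian.
For cokernels (`CisData.IsCart.of_exact`) the functors `- □ 𝒞_x` must be exact, which is left
coflatness.

Smallness. An element of a cartesian object lies in a cartesian subobject obtained by closing it
under structure maps, coefficients of the coaction, and preimages under `V_x → V_y ⊗ 𝒞_x`. This
closure is spanned by values of formal terms that do not depend on the object, so up to isomorphism
such subobjects are quotients of free spaces on terms, and form a set `Gen`
(`CisData.Gen.exists_cover`).

Coreflection. Given `E`, let `G` be the direct sum of all generators over `E`, and let `R` be `G`
modulo the images of all generators over `G` that vanish in `E`. The induced `ε : R → E` has no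
nonzero cartesian test map in its kernel (`CisData.eq_zero_of_comp_eq_zero`), which gives uniqueness
of lifts. For existence, cover a cartesian `N` by a direct sum `T` of generators. The composite `T →
N → E` lifts to `R` summand by summand, and the lift kills the cartesian kernel of `T → N` by the
uniqueness just mentioned, so it descends to `N`. Thus `R` is terminal among cartesian objects over
`E`. -/

noncomputable section

/-! ### Linear data of cis-comodules and their morphisms -/

/-- The structure maps of a cis-comodule with underlying family of vector spaces `V`, without
the axioms. -/
structure CisData {K : Type u} [Field K] {X : Type u} [SmallCategory X] (𝒞 : X ⥤ CoalgCat.{u} K)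
    (V : X → Type u) [∀ x, AddCommGroup (V x)] [∀ x, Module K (V x)] where
  ρ (x : X) : V x →ₗ[K] V x ⊗[K] 𝒞.obj x
  map {x y : X} (α : x ⟶ y) : V x →ₗ[K] V y

namespace CisData

variable {K : Type u} [Field K] {X : Type u} [SmallCategory X] {𝒞 : X ⥤ CoalgCat.{u} K}
  {U : X → Type u} [∀ x, AddCommGroup (U x)] [∀ x, Module K (U x)]
  {V : X → Type u} [∀ x, AddCommGroup (V x)] [∀ x, Module K (V x)]
  {W : X → Type u} [∀ x, AddCommGroup (W x)] [∀ x, Module K (W x)]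

/-- The linear map underlying `𝒞_α`. -/
abbrev coalgLin (𝒞 : X ⥤ CoalgCat.{u} K) {x y : X} (α : x ⟶ y) : 𝒞.obj x →ₗ[K] 𝒞.obj y :=
  (𝒞.map α).toCoalgHom.toLinearMap

/-- The axioms of a cis-comodule. -/
structure IsCis (D : CisData 𝒞 V) : Prop where
  coassoc (x : X) : (TensorProduct.assoc K (V x) (𝒞.obj x) (𝒞.obj x)).toLinearMap ∘ₗ
    (D.ρ x).rTensor (𝒞.obj x) ∘ₗ D.ρ x =
      (Coalgebra.comul (R := K) (A := 𝒞.obj x)).lTensor (V x) ∘ₗ D.ρ x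
  counit (x : X) : (Coalgebra.counit (R := K) (A := 𝒞.obj x)).lTensor (V x) ∘ₗ D.ρ x =
    (TensorProduct.mk K (V x) K).flip 1
  comm {x y : X} (α : x ⟶ y) : D.ρ y ∘ₗ D.map α =
    (D.map α).rTensor (𝒞.obj y) ∘ₗ ((coalgLin 𝒞 α).lTensor (V x) ∘ₗ D.ρ x)
  map_id (x : X) : D.map (𝟙 x) = LinearMap.id
  map_comp {x y z : X} (α : x ⟶ y) (β : y ⟶ z) : D.map (α ≫ β) = D.map β ∘ₗ D.map α

/-- A family of linear maps commuting with the coactions and the structure maps. -/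
structure IsMor (D : CisData 𝒞 V) (E : CisData 𝒞 W) (f : ∀ x, V x →ₗ[K] W x) : Prop where
  ρ (x : X) : E.ρ x ∘ₗ f x = (f x).rTensor (𝒞.obj x) ∘ₗ D.ρ x
  map {x y : X} (α : x ⟶ y) : E.map α ∘ₗ f x = f y ∘ₗ D.map α

theorem IsMor.ρ_apply {D : CisData 𝒞 V} {E : CisData 𝒞 W} {f : ∀ x, V x →ₗ[K] W x}
    (hf : IsMor D E f) (x : X) (v : V x) : E.ρ x (f x v) = (f x).rTensor (𝒞.obj x) (D.ρ x v) :=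
  LinearMap.congr_fun (hf.ρ x) v

theorem IsMor.map_apply {D : CisData 𝒞 V} {E : CisData 𝒞 W} {f : ∀ x, V x →ₗ[K] W x}
    (hf : IsMor D E f) {x y : X} (α : x ⟶ y) (v : V x) :
    E.map α (f x v) = f y (D.map α v) :=
  LinearMap.congr_fun (hf.map α) v

theorem IsMor.comp {D : CisData 𝒞 U} {E : CisData 𝒞 V} {F : CisData 𝒞 W}
    {f : ∀ x, U x →ₗ[K] V x} {g : ∀ x, V x →ₗ[K] W x} (hf : IsMor D E f) (hg : IsMor E F g) :
    IsMor D F fun x => g x ∘ₗ f x where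
  ρ x := by
    rw [← LinearMap.comp_assoc, hg.ρ, LinearMap.comp_assoc, hf.ρ, LinearMap.rTensor_comp,
      LinearMap.comp_assoc]
  map α := by
    rw [← LinearMap.comp_assoc, hg.map, LinearMap.comp_assoc, hf.map, LinearMap.comp_assoc]

theorem IsMor.sub {D : CisData 𝒞 V} {E : CisData 𝒞 W} {f g : ∀ x, V x →ₗ[K] W x}
    (hf : IsMor D E f) (hg : IsMor D E g) : IsMor D E fun x => f x - g x where
  ρ x := by
    rw [LinearMap.comp_sub, hf.ρ, hg.ρ, LinearMap.rTensor_sub, LinearMap.sub_comp]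
  map α := by rw [LinearMap.comp_sub, hf.map, hg.map, LinearMap.sub_comp]

theorem IsMor.zero (D : CisData 𝒞 V) (E : CisData 𝒞 W) :
    IsMor D E fun _ => (0 : V _ →ₗ[K] W _) where
  ρ x := by rw [LinearMap.comp_zero, LinearMap.rTensor_zero, LinearMap.zero_comp]
  map α := by rw [LinearMap.comp_zero, LinearMap.zero_comp]

theorem IsMor.id (D : CisData 𝒞 V) : IsMor D D fun _ => LinearMap.id where
  ρ x := by rw [LinearMap.rTensor_id, LinearMap.id_comp, LinearMap.comp_id]
  map α := by rw [LinearMap.id_comp, LinearMap.comp_id]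

/-! ### Transfer of the axioms along morphisms -/

section transfer

variable {D : CisData 𝒞 V} {E : CisData 𝒞 W} {f : ∀ x, V x →ₗ[K] W x}

/-- Both sides of each axiom are composites of structure maps, so a morphism intertwines each side
separately. This and the next lemmas record that, so that an axiom can be cancelled against an
injective morphism or against a jointly epimorphic family. -/
theorem IsMor.coassoc_left (hf : IsMor D E f) (x : X) :
    ((TensorProduct.assoc K (W x) (𝒞.obj x) (𝒞.obj x)).toLinearMap ∘ₗ
      (E.ρ x).rTensor (𝒞.obj x) ∘ₗ E.ρ x) ∘ₗ f x =
    (f x).rTensor (𝒞.obj x ⊗[K] 𝒞.obj x) ∘ₗ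
      ((TensorProduct.assoc K (V x) (𝒞.obj x) (𝒞.obj x)).toLinearMap ∘ₗ
        (D.ρ x).rTensor (𝒞.obj x) ∘ₗ D.ρ x) := by
  have e : (f x).rTensor (𝒞.obj x ⊗[K] 𝒞.obj x) ∘ₗ
      (TensorProduct.assoc K (V x) (𝒞.obj x) (𝒞.obj x)).toLinearMap =
      (TensorProduct.assoc K (W x) (𝒞.obj x) (𝒞.obj x)).toLinearMap ∘ₗ
        ((f x).rTensor (𝒞.obj x)).rTensor (𝒞.obj x) := by
    ext
    simp
  rw [← LinearMap.comp_assoc _ _ (LinearMap.rTensor _ (f x)), e, LinearMap.comp_assoc,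
    LinearMap.comp_assoc, LinearMap.comp_assoc, hf.ρ, ← LinearMap.comp_assoc (D.ρ x),
    ← LinearMap.rTensor_comp, hf.ρ, LinearMap.rTensor_comp, LinearMap.comp_assoc]

theorem IsMor.lTensor_comp_ρ (hf : IsMor D E f) {x : X} {Z : Type u} [AddCommGroup Z]
    [Module K Z] (φ : 𝒞.obj x →ₗ[K] Z) :
    (φ.lTensor (W x) ∘ₗ E.ρ x) ∘ₗ f x = (f x).rTensor Z ∘ₗ (φ.lTensor (V x) ∘ₗ D.ρ x) := by
  rw [LinearMap.comp_assoc, hf.ρ, ← LinearMap.comp_assoc, ← LinearMap.comp_assoc,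
    LinearMap.lTensor_comp_rTensor, LinearMap.rTensor_comp_lTensor]

theorem IsMor.comm_right (hf : IsMor D E f) {x y : X} (α : x ⟶ y) :
    ((E.map α).rTensor (𝒞.obj y) ∘ₗ ((coalgLin 𝒞 α).lTensor (W x) ∘ₗ E.ρ x)) ∘ₗ f x =
    (f y).rTensor (𝒞.obj y) ∘ₗ
      ((D.map α).rTensor (𝒞.obj y) ∘ₗ ((coalgLin 𝒞 α).lTensor (V x) ∘ₗ D.ρ x)) := by
  rw [LinearMap.comp_assoc, hf.lTensor_comp_ρ, ← LinearMap.comp_assoc, ← LinearMap.rTensor_comp,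
    hf.map, LinearMap.rTensor_comp, LinearMap.comp_assoc]

theorem IsMor.comm_left (hf : IsMor D E f) {x y : X} (α : x ⟶ y) :
    (E.ρ y ∘ₗ E.map α) ∘ₗ f x = (f y).rTensor (𝒞.obj y) ∘ₗ (D.ρ y ∘ₗ D.map α) := by
  rw [LinearMap.comp_assoc, hf.map, ← LinearMap.comp_assoc, hf.ρ, LinearMap.comp_assoc]

theorem IsMor.comp_left (hf : IsMor D E f) {x y z : X} (α : x ⟶ y) (β : y ⟶ z) :
    (E.map β ∘ₗ E.map α) ∘ₗ f x = f z ∘ₗ (D.map β ∘ₗ D.map α) := by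
  rw [LinearMap.comp_assoc, hf.map, ← LinearMap.comp_assoc, hf.map, LinearMap.comp_assoc]

theorem mk_flip_one_comp {A B : Type u} [AddCommGroup A] [Module K A] [AddCommGroup B]
    [Module K B] (g : A →ₗ[K] B) :
    (TensorProduct.mk K B K).flip 1 ∘ₗ g = g.rTensor K ∘ₗ (TensorProduct.mk K A K).flip 1 := by
  ext
  simp

theorem rTensor_injective {A B : Type u} [AddCommGroup A] [Module K A] [AddCommGroup B]
    [Module K B] {g : A →ₗ[K] B} (hg : Function.Injective g) (Z : Type u) [AddCommGroup Z]
    [Module K Z] : Function.Injective (g.rTensor Z) :=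
  Module.Flat.rTensor_preserves_injective_linearMap g hg

/-- The axioms of a cis-comodule pass to subobjects. -/
theorem IsCis.of_injective (hE : E.IsCis) (hf : IsMor D E f)
    (inj : ∀ x, Function.Injective (f x)) : D.IsCis where
  coassoc x := by
    rw [← LinearMap.cancel_left (rTensor_injective (inj x) _), ← hf.coassoc_left, hE.coassoc,
      hf.lTensor_comp_ρ]
  counit x := by
    rw [← LinearMap.cancel_left (rTensor_injective (inj x) _), ← hf.lTensor_comp_ρ, hE.counit,
      mk_flip_one_comp]
  comm {x y} α := by
    rw [← LinearMap.cancel_left (rTensor_injective (inj y) _), ← hf.comm_left, hE.comm,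
      hf.comm_right]
  map_id x := by
    rw [← LinearMap.cancel_left (inj x), ← hf.map, hE.map_id, LinearMap.id_comp,
      LinearMap.comp_id]
  map_comp {x y z} α β := by
    rw [← LinearMap.cancel_left (inj z), ← hf.map, hE.map_comp, hf.comp_left]

end transfer

/-- The axioms of a cis-comodule can be checked on a jointly epimorphic family. -/
theorem IsCis.of_jointly_epi {J : Type u} {V : J → X → Type u} [∀ j x, AddCommGroup (V j x)]
    [∀ j x, Module K (V j x)] {D : ∀ j, CisData 𝒞 (V j)} {E : CisData 𝒞 W}
    {f : ∀ j x, V j x →ₗ[K] W x} (hD : ∀ j, (D j).IsCis) (hf : ∀ j, IsMor (D j) E (f j))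
    (epi : ∀ (x : X) (Z : Type u) [AddCommGroup Z] [Module K Z] (g h : W x →ₗ[K] Z),
      (∀ j, g ∘ₗ f j x = h ∘ₗ f j x) → g = h) : E.IsCis where
  coassoc x := epi _ _ _ _ fun j => by
    rw [(hf j).coassoc_left, (hD j).coassoc, (hf j).lTensor_comp_ρ]
  counit x := epi _ _ _ _ fun j => by
    rw [(hf j).lTensor_comp_ρ, (hD j).counit, mk_flip_one_comp]
  comm α := epi _ _ _ _ fun j => by
    rw [(hf j).comm_left, (hD j).comm, (hf j).comm_right]
  map_id x := epi _ _ _ _ fun j => by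
    rw [(hf j).map, (hD j).map_id, LinearMap.id_comp, LinearMap.comp_id]
  map_comp α β := epi _ _ _ _ fun j => by
    rw [(hf j).map, (hD j).map_comp, (hf j).comp_left]

/-! ### The cartesian condition for subobjects and cokernels -/

/-- The map `V_x → V_y ⊗ 𝒞_x` underlying `V_x → α_* V_y`. -/
def theta (D : CisData 𝒞 V) {x y : X} (α : x ⟶ y) : V x →ₗ[K] V y ⊗[K] 𝒞.obj x :=
  (D.map α).rTensor (𝒞.obj x) ∘ₗ D.ρ x

/-- The subspace `V_y □ 𝒞_x` of `V_y ⊗ 𝒞_x`. -/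
def cot (D : CisData 𝒞 V) {x y : X} (α : x ⟶ y) : Submodule K (V y ⊗[K] 𝒞.obj x) :=
  LinearMap.eqLocus
    ((TensorProduct.assoc K (V y) (𝒞.obj y) (𝒞.obj x)).toLinearMap ∘ₗ
      (D.ρ y).rTensor (𝒞.obj x))
    (((coalgLin 𝒞 α).rTensor (𝒞.obj x) ∘ₗ Coalgebra.comul).lTensor (V y))

/-- Cartesian data: every `V_x → V_y □ 𝒞_x` is bijective. -/
structure IsCart (D : CisData 𝒞 V) : Prop where
  inj {x y : X} (α : x ⟶ y) : Function.Injective (D.theta α)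
  surj {x y : X} (α : x ⟶ y) {t : V y ⊗[K] 𝒞.obj x} (ht : t ∈ D.cot α) : ∃ v, D.theta α v = t

theorem IsMor.theta_apply {D : CisData 𝒞 V} {E : CisData 𝒞 W} {f : ∀ x, V x →ₗ[K] W x}
    (hf : IsMor D E f) {x y : X} (α : x ⟶ y) (v : V x) :
    E.theta α (f x v) = (f y).rTensor (𝒞.obj x) (D.theta α v) := by
  have : E.theta α ∘ₗ f x = (f y).rTensor (𝒞.obj x) ∘ₗ D.theta α := by
    rw [theta, theta, LinearMap.comp_assoc, hf.ρ, ← LinearMap.comp_assoc,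
      ← LinearMap.comp_assoc, ← LinearMap.rTensor_comp, ← LinearMap.rTensor_comp, hf.map]
  exact LinearMap.congr_fun this v

/-- The right comodule at `x`. -/
def comod {D : CisData 𝒞 V} (hD : D.IsCis) (x : X) : RightComod K (𝒞.obj x) where
  carrier := V x
  ρ := D.ρ x
  coassoc := hD.coassoc x
  counit := hD.counit x

/-- By coassociativity the coaction of `V_x` takes values in `α^* V_x □ 𝒞_x`; coinduction applied to
the comodule map `α^* V_x → V_y` then carries this into `V_y □ 𝒞_x`. -/
theorem IsCis.theta_mem {D : CisData 𝒞 V} (hD : D.IsCis) {x y : X} (α : x ⟶ y) (v : V x) :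
    D.theta α v ∈ D.cot α :=
  let f : (RightComod.corestrict (𝒞.map α).toCoalgHom).obj (comod hD x) ⟶ comod hD y :=
    { lin := D.map α
      comm := hD.comm α }
  RightComod.rTensor_mem_cotensor (𝒞.map α).toCoalgHom f
    ⟨D.ρ x v, RightComod.coaction_mem_cotensor (𝒞.map α).toCoalgHom (comod hD x) v⟩

/-- The component at `x` of a morphism. -/
def comodHom {D : CisData 𝒞 V} {E : CisData 𝒞 W} {f : ∀ x, V x →ₗ[K] W x}
    (hD : D.IsCis) (hE : E.IsCis) (hf : IsMor D E f) (x : X) : comod hD x ⟶ comod hE x where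
  lin := f x
  comm := hf.ρ x

theorem IsMor.mem_cot {D : CisData 𝒞 V} {E : CisData 𝒞 W} {f : ∀ x, V x →ₗ[K] W x}
    (hD : D.IsCis) (hE : E.IsCis) (hf : IsMor D E f) {x y : X} (α : x ⟶ y)
    {t : V y ⊗[K] 𝒞.obj x} (ht : t ∈ D.cot α) : (f y).rTensor (𝒞.obj x) t ∈ E.cot α :=
  RightComod.rTensor_mem_cotensor (𝒞.map α).toCoalgHom (comodHom hD hE hf y) ⟨t, ht⟩

/-- Left coflatness in element form; all later uses of coflatness pass through this statement. -/
theorem cot_exact (hcoflat : IsLeftCoflatRep 𝒞) {D : CisData 𝒞 U} {E : CisData 𝒞 V}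
    {F : CisData 𝒞 W} {f : ∀ x, U x →ₗ[K] V x} {g : ∀ x, V x →ₗ[K] W x}
    (hD : D.IsCis) (hE : E.IsCis) (hF : F.IsCis) (hf : IsMor D E f) (hg : IsMor E F g)
    {x y : X} (α : x ⟶ y) (hex : Function.Exact (f y) (g y)) {t : V y ⊗[K] 𝒞.obj x}
    (ht : t ∈ E.cot α) (h0 : (g y).rTensor (𝒞.obj x) t = 0) :
    ∃ s ∈ D.cot α, (f y).rTensor (𝒞.obj x) s = t := by
  obtain ⟨s, hs⟩ := (hcoflat α (comodHom hD hE hf y) (comodHom hE hF hg y) hex ⟨t, ht⟩).1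
    (Subtype.ext h0)
  exact ⟨s.1, s.2, congrArg Subtype.val hs⟩

theorem cot_surjective (hcoflat : IsLeftCoflatRep 𝒞) {D : CisData 𝒞 V} {E : CisData 𝒞 W}
    {f : ∀ x, V x →ₗ[K] W x} (hD : D.IsCis) (hE : E.IsCis) (hf : IsMor D E f)
    {x y : X} (α : x ⟶ y) (hs : Function.Surjective (f y)) {t : W y ⊗[K] 𝒞.obj x}
    (ht : t ∈ E.cot α) : ∃ s ∈ D.cot α, (f y).rTensor (𝒞.obj x) s = t :=
  -- Surjectivity of `f y` is exactness of `V_y → W_y → W_y` with second map zero.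
  cot_exact hcoflat hD hE hE hf (IsMor.zero E E) α
    (fun w => ⟨fun _ => hs w, fun _ => rfl⟩) ht (by simp)

/-- A subobject of a cartesian object is cartesian as soon as it is saturated. -/
theorem IsCart.of_injective {D : CisData 𝒞 V} {E : CisData 𝒞 W} {f : ∀ x, V x →ₗ[K] W x}
    (hD : D.IsCis) (hE : E.IsCis) (hc : E.IsCart) (hf : IsMor D E f)
    (inj : ∀ x, Function.Injective (f x))
    (sat : ∀ {x y : X} (α : x ⟶ y) (w : W x) (t : V y ⊗[K] 𝒞.obj x),
      E.theta α w = (f y).rTensor (𝒞.obj x) t → ∃ v, f x v = w) : D.IsCart where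
  inj {x y} α v v' h := by
    apply inj x
    apply hc.inj α
    rw [hf.theta_apply, hf.theta_apply, h]
  surj {x y} α t ht := by
    obtain ⟨w, hw⟩ := hc.surj α (hf.mem_cot hD hE α ht)
    obtain ⟨v, rfl⟩ := sat α w t hw
    exact ⟨v, rTensor_injective (inj y) _ (by rw [← hf.theta_apply, hw])⟩

/-- A cokernel of a morphism of cartesian objects is cartesian. -/
theorem IsCart.of_exact (hcoflat : IsLeftCoflatRep 𝒞) {D : CisData 𝒞 U} {E : CisData 𝒞 V}
    {F : CisData 𝒞 W} {f : ∀ x, U x →ₗ[K] V x} {g : ∀ x, V x →ₗ[K] W x}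
    (hD : D.IsCis) (hE : E.IsCis) (hF : F.IsCis) (hf : IsMor D E f) (hg : IsMor E F g)
    (cD : D.IsCart) (cE : E.IsCart) (hex : ∀ x, Function.Exact (f x) (g x))
    (hs : ∀ x, Function.Surjective (g x)) : F.IsCart where
  inj {x y} α := by
    rw [← LinearMap.ker_eq_bot, LinearMap.ker_eq_bot']
    intro w hw
    obtain ⟨v, rfl⟩ := hs x w
    have hmem : E.theta α v ∈ E.cot α := hE.theta_mem α v
    rw [hg.theta_apply] at hw
    -- The element `E.theta α v` dies in `W_y □ 𝒞_x`, so by coflatness it comes from `U_y □ 𝒞_x`,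
    -- hence from some `u` in `U_x`. Injectivity for `E` gives `v = f x u`, which dies in `W_x`.
    obtain ⟨s, hs, hst⟩ := cot_exact hcoflat hD hE hF hf hg α (hex y) hmem hw
    obtain ⟨u, rfl⟩ := cD.surj α hs
    rw [← hf.theta_apply] at hst
    rw [← cE.inj α hst]
    exact (hex x).apply_apply_eq_zero u
  surj {x y} α t ht := by
    obtain ⟨s, hs, rfl⟩ := cot_surjective hcoflat hE hF hg α (hs y) ht
    obtain ⟨v, rfl⟩ := cE.surj α hs
    exact ⟨g x v, hg.theta_apply α v⟩

end CisData

/-! ### Linear algebra: factorization through injections, maps out of direct sums -/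

/-- The factorization of a linear map through an injective one. -/
def LinearMap.factorThrough {K A B Z : Type u} [Field K] [AddCommGroup A] [Module K A]
    [AddCommGroup B] [Module K B] [AddCommGroup Z] [Module K Z] (g : A →ₗ[K] B)
    (hg : Function.Injective g) (h : Z →ₗ[K] B) (hh : ∀ z, ∃ a, g a = h z) : Z →ₗ[K] A :=
  (LinearEquiv.ofInjective g hg).symm.toLinearMap ∘ₗ LinearMap.codRestrict _ h hh

theorem LinearMap.comp_factorThrough {K A B Z : Type u} [Field K] [AddCommGroup A] [Module K A]
    [AddCommGroup B] [Module K B] [AddCommGroup Z] [Module K Z] (g : A →ₗ[K] B)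
    (hg : Function.Injective g) (h : Z →ₗ[K] B) (hh : ∀ z, ∃ a, g a = h z) :
    g ∘ₗ LinearMap.factorThrough g hg h hh = h := by
  ext z
  exact congrArg Subtype.val
    ((LinearEquiv.ofInjective g hg).apply_symm_apply (LinearMap.codRestrict _ h hh z))

namespace CisData

section directSumMaps

open scoped Classical DirectSum

variable {K : Type u} [Field K] {X J : Type u} {V : J → X → Type u} [∀ j x, AddCommGroup (V j x)]
  [∀ j x, Module K (V j x)] {W : X → Type u} [∀ x, AddCommGroup (W x)] [∀ x, Module K (W x)]

/-- The inclusion of a summand. -/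
def sumInj (K : Type u) [Field K] (V : J → X → Type u) [∀ j x, AddCommGroup (V j x)] [∀ j x, Module K (V j x)] (j : J)
    (x : X) : V j x →ₗ[K] ⨁ j, V j x :=
  DirectSum.lof K J (fun j => V j x) j

/-- The map out of a direct sum with given components. -/
def sumDesc (f : ∀ j x, V j x →ₗ[K] W x) (x : X) : (⨁ j, V j x) →ₗ[K] W x :=
  DirectSum.toModule K J (W x) fun j => f j x

theorem sumDesc_comp_sumInj (f : ∀ j x, V j x →ₗ[K] W x) (j : J) (x : X) :
    sumDesc f x ∘ₗ sumInj K V j x = f j x := by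
  ext
  simp [sumDesc, sumInj]

theorem sumDesc_sumInj (f : ∀ j x, V j x →ₗ[K] W x) (j : J) (x : X) (v : V j x) :
    sumDesc f x (sumInj K V j x v) = f j x v :=
  LinearMap.congr_fun (sumDesc_comp_sumInj f j x) v

theorem sum_hom_ext {x : X} {Z : Type u} [AddCommGroup Z] [Module K Z]
    {g h : (⨁ j, V j x) →ₗ[K] Z} (H : ∀ j, g ∘ₗ sumInj K V j x = h ∘ₗ sumInj K V j x) : g = h :=
  DirectSum.linearMap_ext K H

end directSumMaps

variable {K : Type u} [Field K] {X : Type u} [SmallCategory X] {𝒞 : X ⥤ CoalgCat.{u} K}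
  {V : X → Type u} [∀ x, AddCommGroup (V x)] [∀ x, Module K (V x)]
  {W : X → Type u} [∀ x, AddCommGroup (W x)] [∀ x, Module K (W x)]

/-! ### Subobjects, kernels and cokernels -/

/-- Subobjects: the data induced along a family of injective maps with stable image. -/
theorem exists_restrict (E : CisData 𝒞 W) (f : ∀ x, V x →ₗ[K] W x)
    (inj : ∀ x, Function.Injective (f x))
    (hρ : ∀ x v, ∃ t, (f x).rTensor (𝒞.obj x) t = E.ρ x (f x v))
    (hmap : ∀ {x y : X} (α : x ⟶ y) (v : V x), ∃ v', f y v' = E.map α (f x v)) :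
    ∃ D : CisData 𝒞 V, IsMor D E f :=
  ⟨{ ρ := fun x => LinearMap.factorThrough _ (rTensor_injective (inj x) _) (E.ρ x ∘ₗ f x) (hρ x)
     map := fun {x y} α => LinearMap.factorThrough _ (inj y) (E.map α ∘ₗ f x) (hmap α) },
   { ρ := fun _ => (LinearMap.comp_factorThrough _ _ _ _).symm
     map := fun _ => (LinearMap.comp_factorThrough _ _ _ _).symm }⟩

/-- Kernels of morphisms of cartesian objects are cartesian. -/
theorem exists_ker {D : CisData 𝒞 V} {E : CisData 𝒞 W} {f : ∀ x, V x →ₗ[K] W x}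
    (hD : D.IsCis) (cD : D.IsCart) (cE : E.IsCart) (hf : IsMor D E f) :
    ∃ L : CisData 𝒞 fun x => LinearMap.ker (f x),
      IsMor L D (fun x => (LinearMap.ker (f x)).subtype) ∧ L.IsCis ∧ L.IsCart := by
  obtain ⟨L, hL⟩ := exists_restrict D (fun x => (LinearMap.ker (f x)).subtype)
    (fun x => Submodule.injective_subtype _)
    (fun x v => by
      have hex : Function.Exact (LinearMap.ker (f x)).subtype (f x) :=
        LinearMap.exact_subtype_ker_map _
      -- Exactness of `- ⊗ 𝒞_x` identifies `ker ⊗ 𝒞_x` with the kernel of `f x ⊗ id`, so stability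
      -- under the coaction is a vanishing statement.
      refine (Module.Flat.rTensor_exact (𝒞.obj x) hex _).1 ?_
      rw [← hf.ρ_apply, hex.apply_apply_eq_zero, map_zero])
    (fun {x y} α v => ⟨⟨D.map α v, by
      rw [LinearMap.mem_ker, ← hf.map_apply, show f x v = 0 from v.2, map_zero]⟩, rfl⟩)
  have cis : L.IsCis := hD.of_injective hL fun x => Submodule.injective_subtype _
  refine ⟨L, hL, cis, cD.of_injective cis hD hL
    (fun x => Submodule.injective_subtype _) fun {x y} α w t h => ?_⟩
  -- Saturation of the kernel: if `D.theta α w` comes from `ker ⊗ 𝒞_x`, then `E.theta α` kills `f x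
  -- w`, and it is injective.
  refine ⟨⟨w, cE.inj α ?_⟩, rfl⟩
  have h0 : f y ∘ₗ (LinearMap.ker (f y)).subtype = 0 := LinearMap.comp_ker_subtype _
  rw [hf.theta_apply, h, map_zero, ← LinearMap.comp_apply, ← LinearMap.rTensor_comp, h0,
    LinearMap.rTensor_zero, LinearMap.zero_apply]

/-- Descent of morphisms along surjective ones. -/
theorem IsMor.of_comp {U : X → Type u} [∀ x, AddCommGroup (U x)] [∀ x, Module K (U x)]
    {D : CisData 𝒞 U} {E : CisData 𝒞 V} {F : CisData 𝒞 W} {f : ∀ x, U x →ₗ[K] V x}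
    {g : ∀ x, V x →ₗ[K] W x} (hf : IsMor D E f) (hs : ∀ x, Function.Surjective (f x))
    (h : IsMor D F fun x => g x ∘ₗ f x) : IsMor E F g where
  ρ x := by
    rw [← LinearMap.cancel_right (hs x), LinearMap.comp_assoc, h.ρ, LinearMap.comp_assoc, hf.ρ,
      LinearMap.rTensor_comp, LinearMap.comp_assoc]
  map {x y} α := by
    rw [← LinearMap.cancel_right (hs x), LinearMap.comp_assoc, h.map, LinearMap.comp_assoc,
      LinearMap.comp_assoc, hf.map]

/-- The cokernel of a morphism. -/
theorem exists_coker {D : CisData 𝒞 V} {E : CisData 𝒞 W} {f : ∀ x, V x →ₗ[K] W x}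
    (hf : IsMor D E f) :
    ∃ Q : CisData 𝒞 fun x => W x ⧸ LinearMap.range (f x),
      IsMor E Q (fun x => (LinearMap.range (f x)).mkQ) :=
  ⟨{ ρ := fun x => (LinearMap.range (f x)).liftQ
        ((LinearMap.range (f x)).mkQ.rTensor (𝒞.obj x) ∘ₗ E.ρ x) (by
          rw [LinearMap.range_le_ker_iff, LinearMap.comp_assoc, hf.ρ, ← LinearMap.comp_assoc,
            ← LinearMap.rTensor_comp, LinearMap.range_mkQ_comp, LinearMap.rTensor_zero,
            LinearMap.zero_comp])
     map := fun α => (LinearMap.range (f _)).liftQ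
        ((LinearMap.range (f _)).mkQ ∘ₗ E.map α) (by
          rw [LinearMap.range_le_ker_iff, LinearMap.comp_assoc, hf.map, ← LinearMap.comp_assoc,
            LinearMap.range_mkQ_comp, LinearMap.zero_comp]) },
   { ρ := fun _ => Submodule.liftQ_mkQ _ _ _
     map := fun _ => Submodule.liftQ_mkQ _ _ _ }⟩

/-! ### Direct sums of cis-comodules and of cartesian objects -/

section directSum

open scoped Classical DirectSum

variable {J : Type u} {V : J → X → Type u} [∀ j x, AddCommGroup (V j x)]
  [∀ j x, Module K (V j x)]

/-- The direct sum of a family. -/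
def sum (D : ∀ j, CisData 𝒞 (V j)) : CisData 𝒞 fun x => ⨁ j, V j x where
  ρ x := DirectSum.toModule K J _ fun j =>
    (DirectSum.lof K J (fun j => V j x) j).rTensor (𝒞.obj x) ∘ₗ (D j).ρ x
  map {_ y} α := DirectSum.toModule K J _ fun j =>
    DirectSum.lof K J (fun j => V j y) j ∘ₗ (D j).map α

theorem isMor_sumInj (D : ∀ j, CisData 𝒞 (V j)) (j : J) :
    IsMor (D j) (sum D) (sumInj K V j) where
  ρ x := by
    ext v
    simp [sum, sumInj]
  map α := by
    ext v
    simp [sum, sumInj]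

theorem isMor_sumDesc {D : ∀ j, CisData 𝒞 (V j)} {E : CisData 𝒞 W}
    {f : ∀ j x, V j x →ₗ[K] W x} (hf : ∀ j, IsMor (D j) E (f j)) :
    IsMor (sum D) E (sumDesc f) where
  ρ x := sum_hom_ext fun j => by
    rw [LinearMap.comp_assoc, sumDesc_comp_sumInj, LinearMap.comp_assoc, (isMor_sumInj D j).ρ,
      ← LinearMap.comp_assoc, ← LinearMap.rTensor_comp, sumDesc_comp_sumInj, (hf j).ρ]
  map α := sum_hom_ext fun j => by
    rw [LinearMap.comp_assoc, sumDesc_comp_sumInj, LinearMap.comp_assoc, (isMor_sumInj D j).map,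
      ← LinearMap.comp_assoc, sumDesc_comp_sumInj, (hf j).map]

/-- The projection is the map out of the direct sum whose components are the identity or zero, and
these are morphisms. -/
theorem isMor_component (D : ∀ j, CisData 𝒞 (V j)) (i : J) :
    IsMor (sum D) (D i) fun x => DirectSum.component K J (fun j => V j x) i := by
  let f : ∀ j x, V j x →ₗ[K] V i x := fun j x =>
    DirectSum.component K J (fun j => V j x) i ∘ₗ sumInj K V j x
  have hf : ∀ j, IsMor (D j) (D i) (f j) := by
    intro j
    by_cases h : j = i
    · subst h
      have : f j = fun x => LinearMap.id := by
        ext x : 1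
        exact DirectSum.component_comp_lof_same K j
      rw [this]
      exact IsMor.id _
    · have : f j = fun x => 0 := by
        ext x : 1
        simp [f, sumInj, DirectSum.component_comp_lof, h]
      rw [this]
      exact IsMor.zero _ _
  have := isMor_sumDesc hf
  convert this using 2 with x
  exact sum_hom_ext fun j => (sumDesc_comp_sumInj f j x).symm

theorem IsCis.sum {D : ∀ j, CisData 𝒞 (V j)} (hD : ∀ j, (D j).IsCis) : (sum D).IsCis :=
  IsCis.of_jointly_epi hD (isMor_sumInj D) fun _ _ _ _ _ _ h => sum_hom_ext h

theorem exists_component_eq {V : J → Type u} [∀ j, AddCommGroup (V j)] [∀ j, Module K (V j)]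
    {i j : J} (h : i ≠ j) (a : V i) (b : V j) :
    ∃ w : ⨁ j, V j, DirectSum.component K J V i w = a ∧ DirectSum.component K J V j w = b :=
  ⟨DirectSum.lof K J V i a + DirectSum.lof K J V j b, by
    simp [DirectSum.component.of, h, h.symm]⟩

/-- A tensor involves only finitely many summands. This lets an equation in `(⨁ V_j) ⊗ Z` be solved
one component at a time. -/
theorem exists_sum_component {V : J → Type u} [∀ j, AddCommGroup (V j)] [∀ j, Module K (V j)]
    {Z : Type u} [AddCommGroup Z] [Module K Z] (t : (⨁ j, V j) ⊗[K] Z) :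
    ∃ s : Finset J, t = ∑ j ∈ s, (DirectSum.lof K J V j).rTensor Z
      ((DirectSum.component K J V j).rTensor Z t) := by
  -- Asking for all larger index sets makes the claim additive: a union of two such sets serves for
  -- a sum of tensors.
  suffices h : ∃ s : Finset J, ∀ s', s ⊆ s' → t = ∑ j ∈ s', (DirectSum.lof K J V j).rTensor Z
      ((DirectSum.component K J V j).rTensor Z t) by
    obtain ⟨s, hs⟩ := h
    exact ⟨s, hs s subset_rfl⟩
  have hadd : ∀ a b : (⨁ j, V j) ⊗[K] Z,
      (∃ s : Finset J, ∀ s', s ⊆ s' → a = ∑ j ∈ s', (DirectSum.lof K J V j).rTensor Z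
        ((DirectSum.component K J V j).rTensor Z a)) →
      (∃ s : Finset J, ∀ s', s ⊆ s' → b = ∑ j ∈ s', (DirectSum.lof K J V j).rTensor Z
        ((DirectSum.component K J V j).rTensor Z b)) →
      ∃ s : Finset J, ∀ s', s ⊆ s' → a + b = ∑ j ∈ s', (DirectSum.lof K J V j).rTensor Z
        ((DirectSum.component K J V j).rTensor Z (a + b)) := by
    rintro a b ⟨s, hs⟩ ⟨s', hs'⟩
    refine ⟨s ∪ s', fun r hr => ?_⟩
    simp only [map_add, Finset.sum_add_distrib]
    rw [← hs r (Finset.union_subset_left hr), ← hs' r (Finset.union_subset_right hr)]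
  induction t with
  | zero => exact ⟨∅, by simp⟩
  | add a b ha hb => exact hadd a b ha hb
  | tmul m z =>
    induction m using DirectSum.induction_on with
    | zero => exact ⟨∅, by simp⟩
    | add a b ha hb => rw [TensorProduct.add_tmul]; exact hadd _ _ ha hb
    | of i v =>
      refine ⟨{i}, fun s' hs' => ?_⟩
      rw [← DirectSum.lof_eq_of K, Finset.sum_eq_single_of_mem i (hs' (by simp))]
      · simp
      · intro j _ hj
        simp [DirectSum.component.of, hj.symm]

/-- Projections are morphisms, so both injectivity and preimages reduce to the summands. Preimages
are chosen for every index, but only the finitely many that occur in the given tensor are added up.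
-/
theorem IsCart.sum {D : ∀ j, CisData 𝒞 (V j)} (hD : ∀ j, (D j).IsCis)
    (cD : ∀ j, (D j).IsCart) : (sum D).IsCart where
  inj {x y} α := by
    rw [← LinearMap.ker_eq_bot, LinearMap.ker_eq_bot']
    intro w hw
    refine DirectSum.ext_component K fun j => (cD j).inj α ?_
    rw [(isMor_component D j).theta_apply, hw, map_zero, map_zero, map_zero]
  surj {x y} α t ht := by
    choose w hw using fun j => (cD j).surj α
      ((isMor_component D j).mem_cot (IsCis.sum hD) (hD j) α ht)
    obtain ⟨s, hs⟩ := exists_sum_component t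
    refine ⟨∑ j ∈ s, sumInj K V j x (w j), ?_⟩
    rw [map_sum]
    refine Eq.trans ?_ hs.symm
    refine Finset.sum_congr rfl fun j _ => ?_
    rw [(isMor_sumInj D j).theta_apply, hw]
    rfl

end directSum

end CisData

/-! ### A small set of generators for the cartesian objects -/

namespace CisData

variable {K : Type u} [Field K] {X : Type u} [SmallCategory X] {𝒞 : X ⥤ CoalgCat.{u} K}
  {V : X → Type u} [∀ x, AddCommGroup (V x)] [∀ x, Module K (V x)]

/-- Formal expressions for the elements that a cartesian subobject has to contain together with a
given element at `x₀`. -/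
inductive Term (𝒞 : X ⥤ CoalgCat.{u} K) (x₀ : X) : X → Type u
  | gen : Term 𝒞 x₀ x₀
  | map {x y : X} (α : x ⟶ y) (t : Term 𝒞 x₀ x) : Term 𝒞 x₀ y
  | act {x : X} (φ : 𝒞.obj x →ₗ[K] K) (t : Term 𝒞 x₀ x) : Term 𝒞 x₀ x
  | cores {x y : X} (α : x ⟶ y) (n : ℕ) (t : Fin n → Term 𝒞 x₀ y) (c : Fin n → 𝒞.obj x) :
      Term 𝒞 x₀ x

open scoped Classical in
/-- The value of a formal expression; `cores α n t c` is sent to the element whose image in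
`V_y ⊗ 𝒞_x` is `∑ tᵢ ⊗ cᵢ`, if there is one. -/
def Term.eval (D : CisData 𝒞 V) {x₀ : X} (v₀ : V x₀) : ∀ {x : X}, Term 𝒞 x₀ x → V x
  | _, .gen => v₀
  | _, .map α t => D.map α (t.eval D v₀)
  | _, .act φ t => TensorProduct.rid K _ (φ.lTensor _ (D.ρ _ (t.eval D v₀)))
  | _, .cores α _ t c =>
    -- For cartesian `D` the preimage is unique, so the choice does no harm; the default `0` adds
    -- nothing to the span of the values.
    if h : ∃ w, D.theta α w = ∑ i, (t i).eval D v₀ ⊗ₜ[K] c i then h.choose else 0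

/-- The linear extension of `Term.eval`. -/
def Term.evalLin (D : CisData 𝒞 V) {x₀ : X} (v₀ : V x₀) (x : X) :
    (Term 𝒞 x₀ x →₀ K) →ₗ[K] V x :=
  Finsupp.linearCombination K (Term.eval D v₀)

theorem Term.apply_mem_range {D : CisData 𝒞 V} {x₀ : X} {v₀ : V x₀} {x y : X}
    (A : V x →ₗ[K] V y) (hA : ∀ t : Term 𝒞 x₀ x, ∃ t' : Term 𝒞 x₀ y,
      A (t.eval D v₀) = t'.eval D v₀) {v : V x} (hv : v ∈ LinearMap.range (evalLin D v₀ x)) :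
    A v ∈ LinearMap.range (evalLin D v₀ y) := by
  revert v
  change LinearMap.range (evalLin D v₀ x) ≤ (LinearMap.range (evalLin D v₀ y)).comap A
  rw [evalLin, evalLin, Finsupp.range_linearCombination, Finsupp.range_linearCombination,
    Submodule.span_le]
  rintro _ ⟨t, rfl⟩
  obtain ⟨t', ht'⟩ := hA t
  change A (t.eval D v₀) ∈ Submodule.span K (Set.range (Term.eval D v₀))
  rw [ht']
  exact Submodule.subset_span ⟨t', rfl⟩

/-- Expand `t` in a basis of `Z`: its coefficients are its contractions with the coordinate
functionals. Hence closing under the `act` terms is enough for stability under the coaction. -/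
theorem mem_range_rTensor {A B Z : Type u} [AddCommGroup A] [Module K A]
    [AddCommGroup B] [Module K B] [AddCommGroup Z] [Module K Z] (g : A →ₗ[K] B) (t : B ⊗[K] Z)
    (h : ∀ φ : Z →ₗ[K] K, TensorProduct.rid K B (φ.lTensor B t) ∈ LinearMap.range g) :
    t ∈ LinearMap.range (g.rTensor Z) := by
  classical
  let b := Module.Basis.ofVectorSpace K Z
  rw [← (TensorProduct.equivFinsuppOfBasisRight b).symm_apply_apply t,
    TensorProduct.equivFinsuppOfBasisRight_symm_apply]
  refine Submodule.sum_mem _ fun i _ => ?_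
  obtain ⟨a, ha⟩ := h (b.coord i)
  rw [TensorProduct.equivFinsuppOfBasisRight_apply, ← ha]
  exact ⟨a ⊗ₜ b i, rfl⟩

/-- Brings a tensor into the shape accepted by `Term.cores`. Scalars are absorbed into the second
factor, so terms need no linear operations. -/
theorem exists_sum_tmul {D : CisData 𝒞 V} {x₀ : X} {v₀ : V x₀} {y : X} {A Z : Type u}
    [AddCommGroup A] [Module K A] [AddCommGroup Z] [Module K Z] (g : A →ₗ[K] V y)
    (hg : LinearMap.range g ≤ LinearMap.range (Term.evalLin D v₀ y)) (t : A ⊗[K] Z) :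
    ∃ (n : ℕ) (s : Fin n → Term 𝒞 x₀ y) (c : Fin n → Z),
      g.rTensor Z t = ∑ i, (s i).eval D v₀ ⊗ₜ[K] c i := by
  have hadd : ∀ a b : V y ⊗[K] Z,
      (∃ (n : ℕ) (s : Fin n → Term 𝒞 x₀ y) (c : Fin n → Z),
        a = ∑ i, (s i).eval D v₀ ⊗ₜ[K] c i) →
      (∃ (n : ℕ) (s : Fin n → Term 𝒞 x₀ y) (c : Fin n → Z),
        b = ∑ i, (s i).eval D v₀ ⊗ₜ[K] c i) →
      ∃ (n : ℕ) (s : Fin n → Term 𝒞 x₀ y) (c : Fin n → Z),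
        a + b = ∑ i, (s i).eval D v₀ ⊗ₜ[K] c i := by
    rintro _ _ ⟨n, s, c, rfl⟩ ⟨m, s', c', rfl⟩
    exact ⟨n + m, Fin.append s s', Fin.append c c', by simp [Fin.sum_univ_add]⟩
  induction t with
  | zero => exact ⟨0, Fin.elim0, Fin.elim0, by simp⟩
  | add a b ha hb => rw [map_add]; exact hadd _ _ ha hb
  | tmul a z =>
    obtain ⟨l, hl⟩ := hg ⟨a, rfl⟩
    rw [LinearMap.rTensor_tmul, ← hl]
    clear hl
    induction l using Finsupp.induction_linear with
    | zero => exact ⟨0, Fin.elim0, Fin.elim0, by simp⟩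
    | add a b ha hb => rw [map_add, TensorProduct.add_tmul]; exact hadd _ _ ha hb
    | single s k =>
      exact ⟨1, fun _ => s, fun _ => k • z, by
        simp [Term.evalLin, TensorProduct.smul_tmul]⟩

/-- Representatives for the cartesian objects generated by a single element. -/
structure Gen (𝒞 : X ⥤ CoalgCat.{u} K) : Type u where
  x₀ : X
  L (x : X) : Submodule K (Term 𝒞 x₀ x →₀ K)
  data : CisData 𝒞 fun x => (Term 𝒞 x₀ x →₀ K) ⧸ L x
  isCis : data.IsCis
  isCart : data.IsCart

/-- The underlying family of vector spaces of a generator. -/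
abbrev Gen.carrier (s : Gen 𝒞) (x : X) : Type u := (Term 𝒞 s.x₀ x →₀ K) ⧸ s.L x

/-- Every element of a cartesian object lies in the image of a generator. -/
theorem Gen.exists_cover {D : CisData 𝒞 V} (hD : D.IsCis) (cD : D.IsCart) {x₀ : X} (v₀ : V x₀) :
    ∃ (s : Gen 𝒞) (f : ∀ x, s.carrier x →ₗ[K] V x), IsMor s.data D f ∧ ∃ v, f x₀ v = v₀ := by
  -- The span of the values is replaced by the isomorphic quotient of the free space on terms, whose
  -- ambient space does not depend on `D`.
  let f : ∀ x, ((Term 𝒞 x₀ x →₀ K) ⧸ LinearMap.ker (Term.evalLin D v₀ x)) →ₗ[K] V x :=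
    fun x => (LinearMap.ker (Term.evalLin D v₀ x)).liftQ (Term.evalLin D v₀ x) le_rfl
  have inj : ∀ x, Function.Injective (f x) := fun x =>
    LinearMap.ker_eq_bot.1 (Submodule.ker_liftQ_eq_bot _ _ _ le_rfl)
  have range_f : ∀ x, LinearMap.range (f x) = LinearMap.range (Term.evalLin D v₀ x) := fun x =>
    Submodule.range_liftQ _ _ _
  have mem : ∀ {x} (t : Term 𝒞 x₀ x), t.eval D v₀ ∈ LinearMap.range (f x) := by
    intro x t
    rw [range_f]
    exact ⟨Finsupp.single t 1, by simp [Term.evalLin]⟩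
  obtain ⟨S, hS⟩ := exists_restrict
    (V := fun x => (Term 𝒞 x₀ x →₀ K) ⧸ LinearMap.ker (Term.evalLin D v₀ x)) D f inj
    (fun x v => by
      apply mem_range_rTensor
      intro φ
      have h : f x v ∈ LinearMap.range (f x) := ⟨v, rfl⟩
      rw [range_f] at h ⊢
      exact Term.apply_mem_range ((TensorProduct.rid K (V x)).toLinearMap ∘ₗ
        φ.lTensor (V x) ∘ₗ D.ρ x) (fun t => ⟨.act φ t, rfl⟩) h)
    (fun {x y} α v => by
      have h : f x v ∈ LinearMap.range (f x) := ⟨v, rfl⟩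
      rw [range_f] at h
      have h' := Term.apply_mem_range (D.map α) (fun t => ⟨.map α t, rfl⟩) h
      rwa [← range_f] at h')
  have cis := hD.of_injective hS inj
  refine ⟨⟨x₀, _, S, cis, cD.of_injective cis hD hS inj ?_⟩, f, hS, mem .gen⟩
  intro x y α w t h
  obtain ⟨n, s, c, hs⟩ := exists_sum_tmul (f y) (range_f y).le t
  have hex : ∃ w, D.theta α w = ∑ i, (s i).eval D v₀ ⊗ₜ[K] c i := ⟨w, h.trans hs⟩
  -- Saturation: `w` is itself the value of a `cores` term, since `D.theta α` is injective.
  have hw : (Term.cores α n s c).eval D v₀ = w := by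
    apply cD.inj α
    rw [Term.eval, dif_pos hex, hex.choose_spec, h, hs]
  rw [← hw]
  exact mem _

end CisData

/-! ### Dictionary between bundled cis-comodules and linear data -/

theorem RightComod.isIso_iff_bijective {K : Type u} [Field K] {C : Type u} [AddCommGroup C]
    [Module K C] [Coalgebra K C] {M N : RightComod K C} (f : M ⟶ N) :
    IsIso f ↔ Function.Bijective (RightComod.Hom.lin f) := by
  constructor
  · intro h
    refine Function.bijective_iff_has_inverse.2 ⟨RightComod.Hom.lin (inv f), fun m => ?_,
      fun n => ?_⟩
    · exact LinearMap.congr_fun (congrArg RightComod.Hom.lin (IsIso.hom_inv_id f)) m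
    · exact LinearMap.congr_fun (congrArg RightComod.Hom.lin (IsIso.inv_hom_id f)) n
  · intro h
    let e := LinearEquiv.ofBijective (RightComod.Hom.lin f) h
    have he : RightComod.Hom.lin f ∘ₗ e.symm.toLinearMap = LinearMap.id := by
      ext n
      exact e.apply_symm_apply n
    have he' : e.symm.toLinearMap ∘ₗ RightComod.Hom.lin f = LinearMap.id := by
      ext m
      exact e.symm_apply_apply m
    refine ⟨⟨⟨e.symm.toLinearMap, ?_⟩, RightComod.hom_ext he', RightComod.hom_ext he⟩⟩
    rw [← LinearMap.cancel_right h.2, LinearMap.comp_assoc, he', LinearMap.comp_assoc,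
      RightComod.Hom.comm f, ← LinearMap.comp_assoc, ← LinearMap.rTensor_comp, he',
      LinearMap.rTensor_id, LinearMap.comp_id, LinearMap.id_comp]

namespace CisComod

variable {K : Type u} [Field K] {X : Type u} [SmallCategory X] {𝒞 : X ⥤ CoalgCat.{u} K}

/-- The underlying linear data of a cis-comodule. -/
def data (ℳ : CisComod 𝒞) : CisData 𝒞 fun x => (ℳ.obj x).carrier where
  ρ x := (ℳ.obj x).ρ
  map α := RightComod.Hom.lin (ℳ.map α)

theorem data_isCis (ℳ : CisComod 𝒞) : ℳ.data.IsCis where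
  coassoc x := (ℳ.obj x).coassoc
  counit x := (ℳ.obj x).counit
  comm α := RightComod.Hom.comm (ℳ.map α)
  map_id x := LinearMap.ext (ℳ.map_id x)
  map_comp α β := LinearMap.ext (ℳ.map_comp α β)

theorem adjMap_apply (ℳ : CisComod 𝒞) {x y : X} (α : x ⟶ y) (m : (ℳ.obj x).carrier) :
    (show RightComod.cotensor (𝒞.map α).toCoalgHom (ℳ.obj y) from
      RightComod.Hom.lin (ℳ.adjMap α) m).1 = ℳ.data.theta α m :=
  RightComod.corestrictAdj_homEquiv_apply _ _ _

theorem isCartesian_iff (ℳ : CisComod 𝒞) : IsCartesian 𝒞 ℳ ↔ ℳ.data.IsCart := by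
  constructor
  · intro h
    refine ⟨fun {x y} α m m' hm => ?_, fun {x y} α t ht => ?_⟩
    · apply ((RightComod.isIso_iff_bijective _).1 (h α)).1
      apply Subtype.ext
      exact (ℳ.adjMap_apply α m).trans (hm.trans (ℳ.adjMap_apply α m').symm)
    · obtain ⟨m, hm⟩ := ((RightComod.isIso_iff_bijective _).1 (h α)).2 ⟨t, ht⟩
      exact ⟨m, (ℳ.adjMap_apply α m).symm.trans (congrArg Subtype.val hm)⟩
  · intro h x y α
    refine (RightComod.isIso_iff_bijective _).2 ⟨fun m m' hm => h.inj α ?_, fun t => ?_⟩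
    · exact (ℳ.adjMap_apply α m).symm.trans
        ((congrArg Subtype.val hm).trans (ℳ.adjMap_apply α m'))
    · obtain ⟨m, hm⟩ := h.surj α t.2
      exact ⟨m, Subtype.ext ((ℳ.adjMap_apply α m).trans hm)⟩

/-- Naturality is imposed on the adjoint maps `ℳ_α`; transposing the square along `α^* ⊣ α_*` turns
it into commutation with `ℳ^α`. -/
theorem Hom.isMor {ℳ 𝒩 : CisComod 𝒞} (η : ℳ ⟶ 𝒩) :
    CisData.IsMor ℳ.data 𝒩.data fun x => RightComod.Hom.lin (Hom.app η x) where
  ρ x := RightComod.Hom.comm (Hom.app η x)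
  map {x y} α := by
    have h := Hom.naturality η α
    rw [adjMap, adjMap, ← Adjunction.homEquiv_naturality_right,
      ← Adjunction.homEquiv_naturality_left, Equiv.apply_eq_iff_eq] at h
    exact (congrArg RightComod.Hom.lin h).symm

theorem hom_ext_lin {ℳ 𝒩 : CisComod 𝒞} {η θ : ℳ ⟶ 𝒩}
    (h : ∀ x, RightComod.Hom.lin (Hom.app η x) = RightComod.Hom.lin (Hom.app θ x)) : η = θ :=
  Hom.ext (funext fun x => RightComod.hom_ext (h x))

/-- The morphism of cis-comodules with given underlying linear maps. -/
def homOfIsMor {ℳ 𝒩 : CisComod 𝒞} (f : ∀ x, (ℳ.obj x).carrier →ₗ[K] (𝒩.obj x).carrier)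
    (hf : CisData.IsMor ℳ.data 𝒩.data f) : ℳ ⟶ 𝒩 :=
  Hom.mk (fun x => { lin := f x, comm := hf.ρ x }) fun {x y} α => by
    rw [adjMap, adjMap, ← Adjunction.homEquiv_naturality_right,
      ← Adjunction.homEquiv_naturality_left]
    exact congrArg _ (RightComod.hom_ext (hf.map α).symm)

end CisComod

/-! ### Construction of the cartesian coreflection -/

namespace CisData

variable {K : Type u} [Field K] {X : Type u} [SmallCategory X] {𝒞 : X ⥤ CoalgCat.{u} K}
  {U : X → Type u} [∀ x, AddCommGroup (U x)] [∀ x, Module K (U x)]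
  {V : X → Type u} [∀ x, AddCommGroup (V x)] [∀ x, Module K (V x)]
  {W : X → Type u} [∀ x, AddCommGroup (W x)] [∀ x, Module K (W x)]

/-- The cis-comodule with given linear data. -/
def toCisComod {D : CisData 𝒞 V} (hD : D.IsCis) : CisComod 𝒞 where
  obj x := comod hD x
  map α := { lin := D.map α, comm := hD.comm α }
  map_id x := LinearMap.congr_fun (hD.map_id x)
  map_comp α β := LinearMap.congr_fun (hD.map_comp α β)

/-- Binary products of cartesian objects. -/
theorem exists_prod {D : CisData 𝒞 U} {E : CisData 𝒞 V} (hD : D.IsCis) (hE : E.IsCis)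
    (cD : D.IsCart) (cE : E.IsCart) :
    ∃ (P : CisComod 𝒞) (p : ∀ x, (P.obj x).carrier →ₗ[K] U x)
      (q : ∀ x, (P.obj x).carrier →ₗ[K] V x), P.data.IsCart ∧
      IsMor P.data D p ∧ IsMor P.data E q ∧ ∀ x u v, ∃ w, p x w = u ∧ q x w = v := by
  -- The product is the direct sum over a two-element index type. Bundling lets the two different
  -- families of carriers form one family over `Bool`.
  let N : ULift.{u} Bool → CisComod 𝒞 := fun b => cond b.down (toCisComod hD) (toCisComod hE)
  have cis : (sum fun b => (N b).data).IsCis := IsCis.sum fun b => (N b).data_isCis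
  have cart : (sum fun b => (N b).data).IsCart := IsCart.sum (fun b => (N b).data_isCis) (by
    rintro ⟨_ | _⟩
    exacts [cE, cD])
  exact ⟨toCisComod cis,
    fun x => DirectSum.component K _ (fun b => ((N b).obj x).carrier) ⟨true⟩,
    fun x => DirectSum.component K _ (fun b => ((N b).obj x).carrier) ⟨false⟩, cart,
    isMor_component (fun b => (N b).data) ⟨true⟩, isMor_component (fun b => (N b).data) ⟨false⟩,
    fun x u v => exists_component_eq (V := fun b => ((N b).obj x).carrier)
      (i := ⟨true⟩) (j := ⟨false⟩) (by simp) u v⟩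

/-- Suppose `q : G → R` kills the generators mapping to zero in `E`. Then a morphism from a
cartesian object to `R` is zero as soon as its composition with `R → E` is. -/
theorem eq_zero_of_comp_eq_zero {U' : X → Type u} [∀ x, AddCommGroup (U' x)]
    [∀ x, Module K (U' x)] {G : CisData 𝒞 U} {R : CisData 𝒞 V}
    {q : ∀ x, U x →ₗ[K] V x} {ε : ∀ x, V x →ₗ[K] W x} (hG : G.IsCis) (cG : G.IsCart)
    (cR : R.IsCart) (hq : IsMor G R q) (hs : ∀ x, Function.Surjective (q x))
    (hK : ∀ (s : Gen 𝒞) (h : ∀ x, s.carrier x →ₗ[K] U x), IsMor s.data G h →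
      (∀ x v, ε x (q x (h x v)) = 0) → ∀ x v, q x (h x v) = 0)
    {D : CisData 𝒞 U'} (hD : D.IsCis) (cD : D.IsCart) {a : ∀ x, U' x →ₗ[K] V x}
    (ha : IsMor D R a) (h0 : ∀ x v, ε x (a x v) = 0) (x : X) (v : U' x) : a x v = 0 := by
  obtain ⟨P, p₁, p₂, cP, hp₁, hp₂, hP⟩ := exists_prod hD hG cD cG
  -- `L` is the pullback of `a` and `q`. On it `ε ∘ q ∘ p₂` equals `ε ∘ a ∘ p₁ = 0`, so `hK` applies
  -- to every generator mapping to `L`.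
  obtain ⟨L, hL, hLc, cL⟩ := exists_ker P.data_isCis cP cR ((hp₁.comp ha).sub (hp₂.comp hq))
  have key : ∀ x, ∀ w : (P.obj x).carrier, a x (p₁ x w) - q x (p₂ x w) = 0 →
      q x (p₂ x w) = 0 := by
    intro x w hw
    obtain ⟨s, f, hf, w', hw'⟩ := Gen.exists_cover hLc cL (x₀ := x) ⟨w, hw⟩
    have := hK s _ ((hf.comp hL).comp hp₂) (fun z t => by
      have ht : a z (p₁ z (f z t).1) - q z (p₂ z (f z t).1) = 0 := (f z t).2
      change ε z (q z (p₂ z (f z t).1)) = 0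
      rw [← sub_eq_zero.1 ht, h0]) x w'
    change q x (p₂ x (f x w').1) = 0 at this
    rwa [hw'] at this
  -- Surjectivity of `q` puts `v` in the image of `L → D`: the pair `(v, g)` is a point of the
  -- pullback.
  obtain ⟨g, hg⟩ := hs x (a x v)
  obtain ⟨w, rfl, rfl⟩ := hP x v g
  rw [← hg]
  exact key x w (sub_eq_zero.2 hg.symm)

/-- Direct sums of cartesian objects. -/
theorem exists_coproduct {J : Type u} {V : J → X → Type u} [∀ j x, AddCommGroup (V j x)]
    [∀ j x, Module K (V j x)] {D : ∀ j, CisData 𝒞 (V j)} (hD : ∀ j, (D j).IsCis)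
    (cD : ∀ j, (D j).IsCart) :
    ∃ (T : CisComod 𝒞) (i : ∀ j x, V j x →ₗ[K] (T.obj x).carrier), T.data.IsCart ∧
      (∀ j, IsMor (D j) T.data (i j)) ∧
      (∀ (W : X → Type u) [∀ x, AddCommGroup (W x)] [∀ x, Module K (W x)] (E : CisData 𝒞 W)
        (f : ∀ j x, V j x →ₗ[K] W x), (∀ j, IsMor (D j) E (f j)) →
        ∃ g : ∀ x, (T.obj x).carrier →ₗ[K] W x, IsMor T.data E g ∧
          ∀ j x v, g x (i j x v) = f j x v) ∧
      ∀ (x : X) (Z : Type u) [AddCommGroup Z] [Module K Z] (g h : (T.obj x).carrier →ₗ[K] Z),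
        (∀ j v, g (i j x v) = h (i j x v)) → g = h :=
  ⟨toCisComod (IsCis.sum hD), sumInj K V, IsCart.sum hD cD, isMor_sumInj D,
    fun _ _ _ _ f hf => ⟨sumDesc f, isMor_sumDesc hf, sumDesc_sumInj f⟩,
    fun _ _ _ _ _ _ H => sum_hom_ext fun j => LinearMap.ext (H j)⟩

/-- Cokernels of morphisms of cartesian objects. -/
theorem exists_cokernel (hcoflat : IsLeftCoflatRep 𝒞) {D : CisData 𝒞 U} {E : CisData 𝒞 V}
    {f : ∀ x, U x →ₗ[K] V x} (hD : D.IsCis) (hE : E.IsCis) (cD : D.IsCart) (cE : E.IsCart)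
    (hf : IsMor D E f) :
    ∃ (R : CisComod 𝒞) (q : ∀ x, V x →ₗ[K] (R.obj x).carrier), R.data.IsCart ∧
      IsMor E R.data q ∧ (∀ x, Function.Surjective (q x)) ∧
      ∀ x, LinearMap.ker (q x) = LinearMap.range (f x) := by
  obtain ⟨R, hq⟩ := exists_coker hf
  have hs : ∀ x, Function.Surjective (LinearMap.range (f x)).mkQ := fun x =>
    Submodule.mkQ_surjective _
  have hR : R.IsCis := IsCis.of_jointly_epi (J := PUnit) (fun _ => hE) (fun _ => hq)
    fun x _ _ _ g h hgh => (LinearMap.cancel_right (hs x)).1 (hgh ⟨⟩)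
  exact ⟨toCisComod hR, _, IsCart.of_exact hcoflat hD hE hR hf hq cD cE
    (fun x => LinearMap.exact_map_mkQ_range _) hs, hq, hs, fun x => Submodule.ker_mkQ _⟩

/-- Factorization of morphisms through surjective ones. -/
theorem IsMor.exists_factor {D : CisData 𝒞 U} {E : CisData 𝒞 V} {F : CisData 𝒞 W}
    {e : ∀ x, U x →ₗ[K] V x} {b : ∀ x, U x →ₗ[K] W x} (he : IsMor D E e) (hb : IsMor D F b)
    (hs : ∀ x, Function.Surjective (e x))
    (hker : ∀ x, LinearMap.ker (e x) ≤ LinearMap.ker (b x)) :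
    ∃ g : ∀ x, V x →ₗ[K] W x, IsMor E F g ∧ ∀ x v, g x (e x v) = b x v := by
  let g := fun x => (LinearMap.ker (e x)).liftQ (b x) (hker x) ∘ₗ
    ((e x).quotKerEquivOfSurjective (hs x)).symm.toLinearMap
  have hge : ∀ x v, g x (e x v) = b x v := by
    intro x v
    change (LinearMap.ker (e x)).liftQ (b x) (hker x)
      (((e x).quotKerEquivOfSurjective (hs x)).symm (e x v)) = _
    rw [LinearMap.quotKerEquivOfSurjective_symm_apply]
    rfl
  have hge' : (fun x => g x ∘ₗ e x) = b := funext fun x => LinearMap.ext (hge x)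
  exact ⟨g, IsMor.of_comp he hs (hge' ▸ hb), hge⟩

/-- A generator over `E`. -/
structure OverGen (E : CisData 𝒞 W) : Type u where
  s : Gen 𝒞
  hom (x : X) : s.carrier x →ₗ[K] W x
  isMor : IsMor s.data E hom

/-- The object `R` over `E`: the direct sum `G` of all generators over `E`, modulo all generators
over `G` that map to zero in `E`. -/
theorem exists_separated_quotient (hcoflat : IsLeftCoflatRep 𝒞) (E : CisData 𝒞 W) :
    ∃ (R : CisComod 𝒞) (ε : ∀ x, (R.obj x).carrier →ₗ[K] W x), R.data.IsCart ∧
      IsMor R.data E ε ∧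
      (∀ i : OverGen E, ∃ g : ∀ x, i.s.carrier x →ₗ[K] (R.obj x).carrier,
        IsMor i.s.data R.data g ∧ ∀ x v, ε x (g x v) = i.hom x v) ∧
      ∀ N : CisComod 𝒞, N.data.IsCart →
        ∀ a : ∀ x, (N.obj x).carrier →ₗ[K] (R.obj x).carrier, IsMor N.data R.data a →
          (∀ x v, ε x (a x v) = 0) → ∀ x v, a x v = 0 := by
  obtain ⟨G, i, cG, hi, descG, -⟩ := exists_coproduct (fun i : OverGen E => i.s.isCis)
    (fun i => i.s.isCart)
  obtain ⟨p, hp, hpi⟩ := descG W E OverGen.hom OverGen.isMor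
  obtain ⟨S, j, cS, hj, descS, extS⟩ := exists_coproduct
    (fun j : {j : OverGen G.data // ∀ x v, p x (j.hom x v) = 0} => j.1.s.isCis)
    (fun j => j.1.s.isCart)
  obtain ⟨k, hk, hkj⟩ := descS _ G.data (fun j => j.1.hom) (fun j => j.1.isMor)
  obtain ⟨R, q, cR, hq, hs, hker⟩ := exists_cokernel hcoflat S.data_isCis G.data_isCis cS cG hk
  have hpk : ∀ x, p x ∘ₗ k x = 0 := fun x => extS x _ _ _ fun j v => by
    rw [LinearMap.comp_apply, hkj, j.2, LinearMap.zero_apply]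
  obtain ⟨ε, hε, hεq⟩ := hq.exists_factor hp hs fun x =>
    (hker x).le.trans (LinearMap.range_le_ker_iff.2 (hpk x))
  refine ⟨R, ε, cR, hε, fun o => ⟨_, (hi o).comp hq, fun x v => ?_⟩, fun N cN a ha h0 => ?_⟩
  · exact (hεq x _).trans (hpi o x v)
  · refine eq_zero_of_comp_eq_zero G.data_isCis cG cR hq hs (fun s h hh h0 x v => ?_)
      N.data_isCis cN ha h0
    -- A generator over `G` that vanishes in `E` is one of the summands of `S`, so its image is
    -- divided out in `R`.
    have hmem : h x v ∈ LinearMap.range (k x) :=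
      ⟨_, hkj ⟨⟨s, h, hh⟩, fun x v => (hεq x _).symm.trans (h0 x v)⟩ x v⟩
    rwa [← hker] at hmem

/-- The cartesian coreflection. -/
theorem exists_coreflection (hcoflat : IsLeftCoflatRep 𝒞) (E : CisData 𝒞 W) :
    ∃ (R : CisComod 𝒞) (ε : ∀ x, (R.obj x).carrier →ₗ[K] W x), R.data.IsCart ∧
      IsMor R.data E ε ∧ ∀ N : CisComod 𝒞, N.data.IsCart →
        (∀ f : ∀ x, (N.obj x).carrier →ₗ[K] W x, IsMor N.data E f →
          ∃ g : ∀ x, (N.obj x).carrier →ₗ[K] (R.obj x).carrier, IsMor N.data R.data g ∧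
            ∀ x, ε x ∘ₗ g x = f x) ∧
        ∀ a : ∀ x, (N.obj x).carrier →ₗ[K] (R.obj x).carrier, IsMor N.data R.data a →
          (∀ x v, ε x (a x v) = 0) → ∀ x v, a x v = 0 := by
  obtain ⟨R, ε, cR, hε, hlift, sep⟩ := exists_separated_quotient hcoflat E
  refine ⟨R, ε, cR, hε, fun N cN => ⟨fun f hf => ?_, sep N cN⟩⟩
  obtain ⟨T, i, cT, hi, descT, extT⟩ := exists_coproduct (fun o : OverGen N.data => o.s.isCis)
    (fun o => o.s.isCart)
  obtain ⟨e, he, hei⟩ := descT _ N.data OverGen.hom OverGen.isMor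
  have hes : ∀ x, Function.Surjective (e x) := by
    intro x n
    obtain ⟨s, h, hh, v, hv⟩ := Gen.exists_cover N.data_isCis cN n
    exact ⟨_, (hei ⟨s, h, hh⟩ x v).trans hv⟩
  -- Composing with `f` turns a generator over `N` into one over `E`, and these lift to `R`.
  choose c hc hεc using fun o : OverGen N.data =>
    hlift ⟨o.s, fun x => f x ∘ₗ o.hom x, o.isMor.comp hf⟩
  obtain ⟨b, hb, hbi⟩ := descT _ R.data c hc
  have hεb : ∀ x, ε x ∘ₗ b x = f x ∘ₗ e x := fun x => extT x _ _ _ fun o v => by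
    rw [LinearMap.comp_apply, LinearMap.comp_apply, hbi, hei]
    exact hεc o x v
  obtain ⟨L, hL, hLc, cL⟩ := exists_ker T.data_isCis cT cN he
  -- The kernel `L` of `e` is cartesian and `ε ∘ b = f ∘ e` vanishes on it, so separatedness of `R`
  -- forces `b` to vanish on it.
  have hker : ∀ x, LinearMap.ker (e x) ≤ LinearMap.ker (b x) := by
    intro x v hv
    refine sep (toCisComod hLc) cL _ (hL.comp hb) (fun x v => ?_) x ⟨v, hv⟩
    refine (LinearMap.congr_fun (hεb x) v.1).trans ?_
    rw [LinearMap.comp_apply, show e x v.1 = 0 from v.2, map_zero]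
  obtain ⟨g, hg, hge⟩ := he.exists_factor hb hes hker
  refine ⟨g, hg, fun x => (LinearMap.cancel_right (hes x)).1 ?_⟩
  rw [← hεb, LinearMap.comp_assoc]
  exact congrArg _ (LinearMap.ext (hge x))

end CisData

/-! ### The right adjoint -/

theorem mainTheorem2 {K : Type u} [Field K] {X : Type u} [PartialOrder X]
    (𝒞 : X ⥤ CoalgCat.{u} K) (hcoflat : IsLeftCoflatRep 𝒞)
    (hsemiperfect : IsRightSemiperfectRep 𝒞) :
    (cartesianInclusion 𝒞).IsLeftAdjoint := by
  -- A right adjoint exists once each category of cartesian objects over `M` has a terminal object;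
  -- the coreflection provides it.
  have h : ∀ M : CisComod 𝒞, Limits.HasTerminal (CostructuredArrow (cartesianInclusion 𝒞) M) := by
    intro M
    obtain ⟨R, ε, cR, hε, hu⟩ := CisData.exists_coreflection hcoflat M.data
    let R' : CartesianCisComod 𝒞 := ⟨R, R.isCartesian_iff.2 cR⟩
    let T : CostructuredArrow (cartesianInclusion 𝒞) M :=
      CostructuredArrow.mk (Y := R') (CisComod.homOfIsMor ε hε)
    have (A : CostructuredArrow (cartesianInclusion 𝒞) M) : Nonempty (A ⟶ T) := by
      obtain ⟨g, hg, hfac⟩ := (hu A.left.obj (A.left.obj.isCartesian_iff.1 A.left.property)).1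
        _ (CisComod.Hom.isMor A.hom)
      exact ⟨CostructuredArrow.homMk (ObjectProperty.homMk (CisComod.homOfIsMor g hg))
        (CisComod.hom_ext_lin hfac)⟩
    have (A : CostructuredArrow (cartesianInclusion 𝒞) M) : Subsingleton (A ⟶ T) := by
      refine ⟨fun a b => CostructuredArrow.hom_ext _ _ (ObjectProperty.hom_ext _
        (CisComod.hom_ext_lin fun x => LinearMap.ext fun v => sub_eq_zero.1 ?_))⟩
      -- The difference of two lifts is a morphism of linear data killed by `ε`, hence zero.
      refine (hu A.left.obj (A.left.obj.isCartesian_iff.1 A.left.property)).2 _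
        ((CisComod.Hom.isMor a.left.hom).sub (CisComod.Hom.isMor b.left.hom)) (fun x v => ?_) x v
      have hab : a.left.hom ≫ T.hom = b.left.hom ≫ T.hom :=
        (CostructuredArrow.w a).trans (CostructuredArrow.w b).symm
      have := LinearMap.congr_fun (congrArg
        (fun η : A.left.obj ⟶ M => RightComod.Hom.lin (CisComod.Hom.app η x)) hab) v
      rw [LinearMap.sub_apply, map_sub]
      exact sub_eq_zero.2 this
    exact Limits.hasTerminal_of_unique T
  exact isLeftAdjoint_of_costructuredArrowTerminals _

end
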